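/- **Notation.** For $x_0\in\mathbb R^3$, $t_0\in\mathbb R$, $r>0$, $z_0=(x_0,t_0)$ let $B_r(x_0)$ be the open ball in $\mathbb R^3$ and $Q_r(z_0)=B_r(x_0)\times(t_0-r^2,t_0)$. For $\sigma\in[0,1]$ let $$\|f\|_{\dot H^{\sigma}(\mathbb R^3)}=\Big(\int_{\mathbb R^3}|\xi|^{2\sigma}|\hat f(\xi)|^2\,d\xi\Big)^{1/2}$$ for a tempered distribution $f$ (infinite if $\hat f$ is not a locally integrable function), let $L^{\sigma,2}(B_r(x_0))$ be the space of all tempered distributions $f$ with $\|f\|_{\dot H^\sigma(\mathbb R^3)}<\infty$ and $\operatorname{supp} f\subset\overline{B_r(x_0)}$, with the norm $\|\cdot\|_{\dot H^\sigma(\mathbb R^3)}$, and let $L^{-\sigma,2}(B_r(x_0))$ be its dual space. A function $f\in L^1_{loc}(B_r(x_0))$ is viewed as an element of $L^{-\sigma,2}(B_r(x_0))$ if some bounded functional on $L^{\sigma,2}(B_r(x_0))$ acts on $C_0^\infty(B_r(x_0))$ as $\varphi\mapsto\int f\varphi$; otherwise $\|f\|_{L^{-\sigma,2}(B_r(x_0))}=\infty$.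 **Suitable weak solutions.** A pair $(u,p)$, with $u$ an $\mathbb R^3$-valued and $p$ a real-valued function, is a suitable weak solution to the Navier–Stokes equations $\partial_tu-\Delta u+u\cdot\nabla u+\nabla p=0$, $\operatorname{div}u=0$ in $Q=\Omega\times(a,b)$ if 1. $u\in L^\infty(a,b;L^2(\Omega))\cap L^2(a,b;W^{1,2}(\Omega))$ and $p\in L^{3/2}(Q)$; 2. $\int_Q\{-u\cdot\psi_t+\nabla u:\nabla\psi-(u\otimes u):\nabla\psi-p\operatorname{div}\psi\}\,dx\,dt=0$ for all $\psi\in C_0^\infty(Q;\mathbb R^3)$, and for a.e. $t\in(a,b)$, $\int_\Omega u(x,t)\cdot\nabla\phi(x)\,dx=0$ for all $\phi\in C_0^\infty(\Omega)$; 3. for every nonnegative $\phi\in C_0^\infty(\mathbb R^3\times\mathbb R)$ vanishing in a neighborhood of $\Omega\times\{a\}\cup\partial\Omega\times[a,b]$ and a.e. $t\in(a,b)$, $$\int_\Omega|u(x,t)|^2\phi(x,t)\,dx+2\int_a^t\!\int_\Omega|\nabla u|^2\phi\,dx\,ds\le\int_a^t\!\int_\Omega|u|^2(\phi_t+\Delta\phi)\,dx\,ds+\int_a^t\!\int_\Omega(|u|^2+2p)\,u\cdot\nabla\phi\,dx\,ds.$$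 **Scaled quantities.** Let $$A(z_0,r)=\operatorname*{ess\,sup}_{t_0-r^2\le t\le t_0}\ r^{-1}\int_{B_r(x_0)}|u(x,t)|^2\,dx,\qquad B(z_0,r)=r^{-1}\int_{Q_r(z_0)}|\nabla u|^2\,dx\,dt,$$ $$C_\sigma(z_0,r)=r^{-\frac{3}{2-\sigma}}\int_{t_0-r^2}^{t_0}\big\||u|^2\big\|_{L^{-\sigma,2}(B_r(x_0))}^{\frac{2}{2-\sigma}}\,dt .$$ **Theorem.** Let $\sigma\in[0,1]$. There is a constant $C>0$, depending only on $\sigma$, such that for all $z_0=(x_0,t_0)\in\mathbb R^3\times\mathbb R$, all $r>0$ and every suitable weak solution $(u,p)$ in $Q_r(z_0)$, $$A(z_0,r/2)+B(z_0,r/2)\le C\,C_\sigma(z_0,r)^{\frac{2-\sigma}{2}}+C\left[r^{-\frac{3}{2-\sigma}}\int_{t_0-r^2}^{t_0}\big\||u|^2+2p\big\|_{L^{-\sigma,2}(B_r(x_0))}^{\frac{2}{2-\sigma}}\,dt\right]^{2-\sigma},$$ where the right-hand side may be infinite. (For $z_0=(0,0)$ and $r=1$ the left-hand side is $\operatorname*{ess\,sup}_{-1/4\le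 t\le0}2\int_{B_{1/2}(0)}|u(x,t)|^2dx+2\int_{Q_{1/2}}|\nabla u|^2\,dx\,ds$.) -/

import Mathlib

open MeasureTheory Set Topology
open scoped ENNReal NNReal ContDiff SchwartzMap FourierTransform

noncomputable section

namespace NavierStokes

/-- Three-dimensional Euclidean space; points of space-time are pairs `z = (x, t)`. -/
abbrev R3 := EuclideanSpace ℝ (Fin 3)

/-! ### Homogeneous Sobolev spaces and the negative order norms -/

/-- The Fourier transform of the tempered distribution `f` is the locally integrable function
`g`. (Mathlib normalizes the Fourier transform with the kernel `exp (-2 π i x · ξ)`.) -/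
def HasFourierFunction (f : 𝓢'(R3, ℂ)) (g : R3 → ℂ) : Prop :=
  LocallyIntegrable g ∧ ∀ ψ : 𝓢(R3, ℂ),
    Integrable (fun ξ => ψ ξ * g ξ) ∧ (𝓕 f) ψ = ∫ ξ, ψ ξ * g ξ

/-- `∫ |ξ|^{2σ} |g(ξ)|² dξ`. -/
def weightedEnergy (σ : ℝ) (g : R3 → ℂ) : ℝ≥0∞ :=
  ∫⁻ ξ, ‖ξ‖ₑ ^ (2 * σ) * ‖g ξ‖ₑ ^ 2

/-- The homogeneous Sobolev norm `(∫ |ξ|^{2σ} |𝓕 f(ξ)|² dξ)^{1/2}` of a tempered distribution;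
it is infinite if the Fourier transform is not a function. The function `g` representing the
Fourier transform is unique up to null sets, so that the infimum is over equal values. -/
def homSobolevNorm (σ : ℝ) (f : 𝓢'(R3, ℂ)) : ℝ≥0∞ :=
  ⨅ (g : R3 → ℂ) (_ : HasFourierFunction f g), weightedEnergy σ g ^ (1 / 2 : ℝ)

lemma homSobolevNorm_lt_top_iff (σ : ℝ) (f : 𝓢'(R3, ℂ)) :
    homSobolevNorm σ f < ⊤ ↔ ∃ g, HasFourierFunction f g ∧ weightedEnergy σ g < ⊤ := by
  simp [homSobolevNorm, iInf_lt_iff, ENNReal.rpow_lt_top_iff_of_pos]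

lemma HasFourierFunction.add {f₁ f₂ : 𝓢'(R3, ℂ)} {g₁ g₂ : R3 → ℂ}
    (h₁ : HasFourierFunction f₁ g₁) (h₂ : HasFourierFunction f₂ g₂) :
    HasFourierFunction (f₁ + f₂) (g₁ + g₂) := by
  refine ⟨h₁.1.add h₂.1, fun ψ => ?_⟩
  have e : (fun ξ => ψ ξ * (g₁ + g₂) ξ) = fun ξ => ψ ξ * g₁ ξ + ψ ξ * g₂ ξ := by
    funext ξ; simp [mul_add]
  rw [e]
  refine ⟨(h₁.2 ψ).1.add (h₂.2 ψ).1, ?_⟩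
  rw [integral_add (h₁.2 ψ).1 (h₂.2 ψ).1, ← (h₁.2 ψ).2, ← (h₂.2 ψ).2]
  simp [TemperedDistribution.fourier_apply]

lemma HasFourierFunction.smul {f : 𝓢'(R3, ℂ)} {g : R3 → ℂ} (c : ℂ)
    (h : HasFourierFunction f g) : HasFourierFunction (c • f) (c • g) := by
  refine ⟨h.1.smul c, fun ψ => ?_⟩
  have e : (fun ξ => ψ ξ * (c • g) ξ) = fun ξ => c * (ψ ξ * g ξ) := by
    funext ξ; simp; ring
  rw [e]
  refine ⟨(h.2 ψ).1.const_mul c, ?_⟩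
  rw [integral_const_mul, ← (h.2 ψ).2]
  simp [TemperedDistribution.fourier_apply]

lemma weightedEnergy_add_lt_top {σ : ℝ} {g₁ g₂ : R3 → ℂ} (hm : LocallyIntegrable g₁)
    (h₁ : weightedEnergy σ g₁ < ⊤) (h₂ : weightedEnergy σ g₂ < ⊤) :
    weightedEnergy σ (g₁ + g₂) < ⊤ := by
  have hle : weightedEnergy σ (g₁ + g₂) ≤
      ∫⁻ ξ : R3, (2 * (‖ξ‖ₑ ^ (2 * σ) * ‖g₁ ξ‖ₑ ^ 2) + 2 * (‖ξ‖ₑ ^ (2 * σ) * ‖g₂ ξ‖ₑ ^ 2)) := by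
    refine lintegral_mono fun ξ => ?_
    have h : ‖(g₁ + g₂) ξ‖ₑ ^ 2 ≤ 2 * ‖g₁ ξ‖ₑ ^ 2 + 2 * ‖g₂ ξ‖ₑ ^ 2 := by
      have h3 := ENNReal.rpow_add_le_mul_rpow_add_rpow ‖g₁ ξ‖ₑ ‖g₂ ξ‖ₑ
        (p := 2) (by norm_num)
      have h4 : (2 : ℝ≥0∞) ^ ((2 : ℝ) - 1) = 2 := by norm_num
      rw [h4] at h3
      simp only [ENNReal.rpow_two] at h3
      calc ‖(g₁ + g₂) ξ‖ₑ ^ 2 ≤ (‖g₁ ξ‖ₑ + ‖g₂ ξ‖ₑ) ^ 2 := by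
            gcongr; exact enorm_add_le _ _
        _ ≤ 2 * (‖g₁ ξ‖ₑ ^ 2 + ‖g₂ ξ‖ₑ ^ 2) := h3
        _ = _ := by ring
    calc ‖ξ‖ₑ ^ (2 * σ) * ‖(g₁ + g₂) ξ‖ₑ ^ 2
        ≤ ‖ξ‖ₑ ^ (2 * σ) * (2 * ‖g₁ ξ‖ₑ ^ 2 + 2 * ‖g₂ ξ‖ₑ ^ 2) := by gcongr
      _ = _ := by ring
  refine hle.trans_lt ?_
  have hm1 : AEMeasurable (fun ξ : R3 => 2 * (‖ξ‖ₑ ^ (2 * σ) * ‖g₁ ξ‖ₑ ^ 2)) := by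
    have := hm.aestronglyMeasurable.enorm
    fun_prop
  rw [lintegral_add_left' hm1, lintegral_const_mul' _ _ (by simp),
    lintegral_const_mul' _ _ (by simp)]
  exact ENNReal.add_lt_top.2 ⟨ENNReal.mul_lt_top (by simp) h₁, ENNReal.mul_lt_top (by simp) h₂⟩

lemma weightedEnergy_smul_lt_top {σ : ℝ} {g : R3 → ℂ} (c : ℂ)
    (h : weightedEnergy σ g < ⊤) : weightedEnergy σ (c • g) < ⊤ := by
  have e : weightedEnergy σ (c • g) = ‖c‖ₑ ^ 2 * weightedEnergy σ g := by
    rw [weightedEnergy, weightedEnergy, ← lintegral_const_mul' _ _ (by simp)]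
    refine lintegral_congr fun ξ => ?_
    simp only [Pi.smul_apply, enorm_smul, mul_pow]
    ring
  rw [e]
  exact ENNReal.mul_lt_top (by simp) h

/-- The space `L^{σ,2}(B_r(x))` of all tempered distributions with finite homogeneous Sobolev norm
whose support is contained in the closed ball. -/
def sobolevBall (σ : ℝ) (x : R3) (r : ℝ) : Submodule ℂ 𝓢'(R3, ℂ) where
  carrier := {f | homSobolevNorm σ f < ⊤ ∧ Distribution.dsupport f ⊆ Metric.closedBall x r}
  zero_mem' := by
    refine ⟨(homSobolevNorm_lt_top_iff σ 0).2 ⟨0, ⟨locallyIntegrable_zero, fun ψ => ?_⟩, ?_⟩, ?_⟩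
    · simp
    · simp [weightedEnergy]
    · intro y hy
      exact absurd hy ((Distribution.notMem_dsupport_iff y).2
        ⟨univ, fun _ _ => rfl, isOpen_univ, mem_univ y⟩)
  add_mem' := by
    rintro f₁ f₂ ⟨h₁, s₁⟩ ⟨h₂, s₂⟩
    refine ⟨?_, ?_⟩
    · obtain ⟨g₁, hg₁, e₁⟩ := (homSobolevNorm_lt_top_iff σ f₁).1 h₁
      obtain ⟨g₂, hg₂, e₂⟩ := (homSobolevNorm_lt_top_iff σ f₂).1 h₂
      exact (homSobolevNorm_lt_top_iff σ _).2
        ⟨g₁ + g₂, hg₁.add hg₂, weightedEnergy_add_lt_top hg₁.1 e₁ e₂⟩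
    · intro y hy
      by_contra hn
      obtain ⟨a, va, oa, ya⟩ := (Distribution.notMem_dsupport_iff y).1 fun h => hn (s₁ h)
      obtain ⟨b, vb, ob, yb⟩ := (Distribution.notMem_dsupport_iff y).1 fun h => hn (s₂ h)
      refine (Distribution.notMem_dsupport_iff y).2
        ⟨a ∩ b, fun ψ hψ => ?_, oa.inter ob, ⟨ya, yb⟩⟩ hy
      have q₁ := va ψ (hψ.trans inter_subset_left)
      have q₂ := vb ψ (hψ.trans inter_subset_right)
      change f₁ ψ + f₂ ψ = 0
      rw [q₁, q₂, add_zero]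
  smul_mem' := by
    rintro c f ⟨h, s⟩
    refine ⟨?_, ?_⟩
    · obtain ⟨g, hg, e⟩ := (homSobolevNorm_lt_top_iff σ f).1 h
      exact (homSobolevNorm_lt_top_iff σ _).2
        ⟨c • g, hg.smul c, weightedEnergy_smul_lt_top c e⟩
    · intro y hy
      by_contra hn
      obtain ⟨a, va, oa, ya⟩ := (Distribution.notMem_dsupport_iff y).1 fun h => hn (s h)
      refine (Distribution.notMem_dsupport_iff y).2 ⟨a, fun ψ hψ => ?_, oa, ya⟩ hy
      change c • f ψ = 0
      rw [va ψ hψ, smul_zero]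

/-- The linear functional `T` on `L^{σ,2}(B_r(x))` is bounded with constant `M`, that is, it is an
element of the dual space `L^{-σ,2}(B_r(x))` of norm at most `M`. -/
def IsBoundedFunctional {σ : ℝ} {x : R3} {r : ℝ} (T : sobolevBall σ x r →ₗ[ℂ] ℂ) (M : ℝ≥0) :
    Prop :=
  ∀ w : sobolevBall σ x r, ‖T w‖ₑ ≤ M * homSobolevNorm σ (w : 𝓢'(R3, ℂ))

/-- The functional `T` on `L^{σ,2}(B_r(x))` is the distribution on `B_r(x)` given by the function
`f`: it acts on the smooth functions with compact support in `B_r(x)` as integration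
against `f`. -/
def Represents {σ : ℝ} {x : R3} {r : ℝ} (T : sobolevBall σ x r →ₗ[ℂ] ℂ) (f : R3 → ℝ) : Prop :=
  LocallyIntegrableOn f (Metric.ball x r) ∧
  ∀ φ : 𝓢(R3, ℂ), tsupport φ ⊆ Metric.ball x r →
    ∀ h : (φ : 𝓢'(R3, ℂ)) ∈ sobolevBall σ x r,
      T ⟨φ, h⟩ = ∫ y in Metric.ball x r, (f y : ℂ) * φ y

/-- The norm of the function `f` in the dual space `L^{-σ,2}(B_r(x))` of `L^{σ,2}(B_r(x))`; it is
infinite if `f` does not define an element of this dual space. -/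
def dualNorm (σ : ℝ) (x : R3) (r : ℝ) (f : R3 → ℝ) : ℝ≥0∞ :=
  ⨅ (M : ℝ≥0) (_ : ∃ T : sobolevBall σ x r →ₗ[ℂ] ℂ, IsBoundedFunctional T M ∧ Represents T f),
    (M : ℝ≥0∞)

/-! ### Suitable weak solutions -/

/-- The partial derivative `∂_j` of a function on space. -/
def pd (j : Fin 3) (f : R3 → ℝ) (x : R3) : ℝ :=
  fderiv ℝ f x (EuclideanSpace.single j 1)

/-- The spatial partial derivative `∂_j` of a function on space-time. -/
def dx (j : Fin 3) (f : R3 × ℝ → ℝ) (z : R3 × ℝ) : ℝ :=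
  fderiv ℝ f z (EuclideanSpace.single j 1, 0)

/-- The time derivative of a function on space-time. -/
def dt (f : R3 × ℝ → ℝ) (z : R3 × ℝ) : ℝ :=
  fderiv ℝ f z (0, 1)

/-- `G = (G_ij) = (∂_j v_i)` is the gradient of the vector field `v` on `Ω` in the weak sense. -/
def IsWeakGradient (Ω : Set R3) (v : R3 → R3) (G : R3 → Matrix (Fin 3) (Fin 3) ℝ) : Prop :=
  ∀ φ : R3 → ℝ, ContDiff ℝ ∞ φ → HasCompactSupport φ → tsupport φ ⊆ Ω →
    ∀ i j, ∫ x in Ω, v x i * pd j φ x = - ∫ x in Ω, G x i j * φ x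

/-- `|M|² = ∑ M_ij²`. -/
def sqNorm (M : Matrix (Fin 3) (Fin 3) ℝ) : ℝ := ∑ i, ∑ j, M i j ^ 2

/-- The parabolic boundary `Ω × {t = a} ∪ ∂Ω × [a, b]` of `Ω × (a, b)`. -/
def parabolicBoundary (Ω : Set R3) (a b : ℝ) : Set (R3 × ℝ) :=
  Ω ×ˢ {a} ∪ frontier Ω ×ˢ Icc a b

/-- `(u, p)` is a suitable weak solution to the Navier-Stokes equations in `Ω × (a, b)`, and `Du` is
the weak spatial gradient of `u`, `Du_ij = ∂_j u_i`. (It is determined by `u` up to a null set and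
is carried along only to have a name for it.) -/
structure IsSuitableWeakSolution (Ω : Set R3) (a b : ℝ) (u : R3 × ℝ → R3)
    (Du : R3 × ℝ → Matrix (Fin 3) (Fin 3) ℝ) (p : R3 × ℝ → ℝ) : Prop where
  /-- `u ∈ L^∞(a, b; L²(Ω))` -/
  u_memLp : MemLp u 2 (volume.restrict (Ω ×ˢ Ioo a b))
  u_bounded : ∃ M : ℝ≥0, ∀ᵐ t, t ∈ Ioo a b → ∫⁻ x in Ω, ‖u (x, t)‖ₑ ^ 2 ≤ M
  /-- `u ∈ L²(a, b; W^{1,2}(Ω))`, with gradient `Du` -/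
  gradient : ∀ᵐ t, t ∈ Ioo a b → IsWeakGradient Ω (fun x => u (x, t)) (fun x => Du (x, t))
  gradient_memLp : ∀ i j, MemLp (fun z => Du z i j) 2 (volume.restrict (Ω ×ˢ Ioo a b))
  /-- `p ∈ L^{3/2}(Ω × (a, b))` -/
  p_memLp : MemLp p (3 / 2) (volume.restrict (Ω ×ˢ Ioo a b))
  /-- the momentum equation in the sense of distributions -/
  momentum : ∀ ψ : R3 × ℝ → R3, ContDiff ℝ ∞ ψ → HasCompactSupport ψ →
    tsupport ψ ⊆ Ω ×ˢ Ioo a b →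
    ∫ z in Ω ×ˢ Ioo a b,
      (- (∑ i, u z i * dt (fun w => ψ w i) z)
        + (∑ i, ∑ j, Du z i j * dx j (fun w => ψ w i) z)
        - (∑ i, ∑ j, u z i * u z j * dx j (fun w => ψ w i) z)
        - p z * ∑ i, dx i (fun w => ψ w i) z) = 0
  /-- `div u = 0` in the sense of distributions, at almost every time -/
  divergence_free : ∀ᵐ t, t ∈ Ioo a b →
    ∀ φ : R3 → ℝ, ContDiff ℝ ∞ φ → HasCompactSupport φ → tsupport φ ⊆ Ω →
      ∫ x in Ω, ∑ j, u (x, t) j * pd j φ x = 0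
  /-- the local generalized energy inequality; the null set of exceptional times may depend on the
  test function -/
  energy : ∀ φ : R3 × ℝ → ℝ, ContDiff ℝ ∞ φ → HasCompactSupport φ → (∀ z, 0 ≤ φ z) →
    (∃ U, IsOpen U ∧ parabolicBoundary Ω a b ⊆ U ∧ ∀ z ∈ U, φ z = 0) →
    ∀ᵐ t, t ∈ Ioo a b →
      (∫ x in Ω, ‖u (x, t)‖ ^ 2 * φ (x, t))
        + 2 * ∫ z in Ω ×ˢ Ioo a t, sqNorm (Du z) * φ z
      ≤ (∫ z in Ω ×ˢ Ioo a t, ‖u z‖ ^ 2 * (dt φ z + ∑ j, dx j (dx j φ) z))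
        + ∫ z in Ω ×ˢ Ioo a t, (‖u z‖ ^ 2 + 2 * p z) * ∑ j, u z j * dx j φ z

/-! ### Scaling invariant quantities -/

/-- `A(z₀, r)`, the supremum over `t₀ - r² ≤ t ≤ t₀` of `r⁻¹ ∫_{B_r(x₀)} |u(x, t)|² dx`; as `u` is
determined only up to null sets, it is the essential supremum. -/
def scaledA (u : R3 × ℝ → R3) (x₀ : R3) (t₀ r : ℝ) : ℝ≥0∞ :=
  essSup (fun t => (ENNReal.ofReal r)⁻¹ * ∫⁻ x in Metric.ball x₀ r, ‖u (x, t)‖ₑ ^ 2)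
    (volume.restrict (Icc (t₀ - r ^ 2) t₀))

/-- `B(z₀, r) = r⁻¹ ∫_{Q_r(z₀)} |∇u|²`, where `Du` is the gradient of `u`. -/
def scaledB (Du : R3 × ℝ → Matrix (Fin 3) (Fin 3) ℝ) (x₀ : R3) (t₀ r : ℝ) : ℝ≥0∞ :=
  (ENNReal.ofReal r)⁻¹ *
    ∫⁻ z in Metric.ball x₀ r ×ˢ Ioo (t₀ - r ^ 2) t₀, ENNReal.ofReal (sqNorm (Du z))

/-- `r^{-3/(2-σ)} ∫_{t₀-r²}^{t₀} ‖f(·, t)‖_{L^{-σ,2}(B_r(x₀))}^{2/(2-σ)} dt`. -/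
def scaledDual (σ : ℝ) (f : R3 × ℝ → ℝ) (x₀ : R3) (t₀ r : ℝ) : ℝ≥0∞ :=
  ENNReal.ofReal r ^ (-(3 / (2 - σ))) *
    ∫⁻ t in Ioo (t₀ - r ^ 2) t₀, dualNorm σ x₀ r (fun x => f (x, t)) ^ (2 / (2 - σ))

/-- `C_σ(z₀, r) = r^{-3/(2-σ)} ∫_{t₀-r²}^{t₀} ‖|u|²‖_{L^{-σ,2}(B_r(x₀))}^{2/(2-σ)} dt`. -/
def scaledC (σ : ℝ) (u : R3 × ℝ → R3) (x₀ : R3) (t₀ r : ℝ) : ℝ≥0∞ :=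
  scaledDual σ (fun z => ‖u z‖ ^ 2) x₀ t₀ r

end NavierStokes

end

/-! The estimate is a localized energy argument. Take a parabolic cutoff `φ` at scale `r`, let
`e(t)` be the integral of `φ|u|²` over the ball at time `t`, `d(t)` that of `φ|∇u|²`, and let `E` be
the larger of `ess sup e` and `∫ d`. The local energy inequality bounds `E` by a linear term,
pairing `|u|²` with `∂ₜφ + Δφ`, plus a flux term, pairing `|u|² + 2p` with `v = u·∇φ`.

At fixed time each pairing is at most the dual norm times the `Ḣ^σ` norm of the multiplier, and
Hölder on the Fourier side gives `‖v‖_{Ḣ^σ} ≤ ‖v‖₂^{1-σ} ‖∇v‖₂^σ` (`weightedEnergy_fourier_le`). In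
the linear term the multiplier is explicit. In the flux term the cutoff is chosen so that `|∇φ|² ≲
φ/r²` and `|∇²φ|² ≲ φ/r⁴`, whence `‖v‖₂² ≲ e/r²` and `‖∇v‖₂² ≲ d/r² + e/r⁴` (`enorm_flux_le`).
Hölder in time with exponents `2/(2-σ)` and `2/σ` then yields `E ≤ P + Q E^{1/2}`, where `P` and `Q`
carry the dual norms of `|u|²` and `|u|² + 2p`. Absorbing `E^{1/2}` squares `Q`, which is why the
second term of the theorem has twice the exponent of the first.

Two points need care. The dual norm sees a function only through smooth test functions, whereas `v`
is merely `W^{1,2}`. So `v` is mollified, and the pairing passes to the limit because `|u|² + 2p` is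
in `L^{3/2}` on interior balls while the mollifications stay bounded in `L³`
(`enorm_integral_le_of_hasWeakGrad`). Also, the dual norm is not known to be measurable in time, so
Hölder is applied to a measurable minorant (`lintegral_le_mul_of_le_mul_rpow`). -/

namespace NavierStokes

/-! ### Fourier side: interpolation of the homogeneous Sobolev norm for test functions -/

lemma lintegral_enorm_sq_fourier (φ : 𝓢(R3, ℂ)) :
    ∫⁻ ξ, ‖𝓕 φ ξ‖ₑ ^ 2 = ∫⁻ x, ‖φ x‖ₑ ^ 2 := by
  have key : ∀ ψ : 𝓢(R3, ℂ), ∫⁻ x, ‖ψ x‖ₑ ^ 2 = ENNReal.ofReal (∫ x, ‖ψ x‖ ^ 2) := by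
    intro ψ
    rw [ofReal_integral_eq_lintegral_ofReal]
    · refine lintegral_congr fun x => ?_
      rw [← ofReal_norm, ENNReal.ofReal_pow (norm_nonneg _)]
    · exact (ψ.memLp 2).integrable_norm_pow (by norm_num)
    · exact Filter.Eventually.of_forall fun x => by positivity
  rw [key, key, SchwartzMap.integral_norm_sq_fourier]

lemma hasFourierFunction_fourier (φ : 𝓢(R3, ℂ)) :
    HasFourierFunction (φ : 𝓢'(R3, ℂ)) (𝓕 φ : 𝓢(R3, ℂ)) := by
  refine ⟨(SchwartzMap.integrable (𝓕 φ)).locallyIntegrable, fun ψ => ⟨?_, ?_⟩⟩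
  · have := (SchwartzMap.smulLeftCLM ℂ (ψ : R3 → ℂ) (𝓕 φ)).integrable (μ := volume)
    refine this.congr (Filter.Eventually.of_forall fun x => ?_)
    simp [SchwartzMap.smulLeftCLM_apply_apply ψ.hasTemperateGrowth]
  · rw [TemperedDistribution.fourier_toTemperedDistributionCLM_eq, SchwartzMap.coe_apply]
    simp

/-- The energy of the partial derivatives of a function. -/
noncomputable def gradEnergy (φ : R3 → ℝ) : ℝ≥0∞ := ∑ j, ∫⁻ x, ‖pd j φ x‖ₑ ^ 2

open LineDeriv in
-- Plancherel applied to each partial derivative, whose Fourier transform is `2πi ξ_j` times that of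
-- `φ`. Only an inequality is kept, since the factor `(2π)²` is discarded.
lemma lintegral_enorm_mul_fourier_le (φ : 𝓢(R3, ℂ)) :
    ∫⁻ ξ, ‖ξ‖ₑ ^ 2 * ‖𝓕 φ ξ‖ₑ ^ 2 ≤
      ∑ j, ∫⁻ x, ‖fderiv ℝ φ x (EuclideanSpace.single j 1)‖ₑ ^ 2 := by
  have h1 : ∀ j : Fin 3, ∫⁻ x, ‖fderiv ℝ φ x (EuclideanSpace.single j 1)‖ₑ ^ 2 =
      ∫⁻ ξ, ‖(2 * Real.pi * Complex.I) * ((ξ j : ℂ) * 𝓕 φ ξ)‖ₑ ^ 2 := by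
    intro j
    have := lintegral_enorm_sq_fourier (∂_{(EuclideanSpace.single j (1:ℝ) : R3)} φ)
    rw [SchwartzMap.fourier_lineDerivOp_eq] at this
    have hg : (fun ξ : R3 => (inner ℝ ξ (EuclideanSpace.single j (1:ℝ) : R3))).HasTemperateGrowth :=
      ((innerSL ℝ).flip (EuclideanSpace.single j (1:ℝ) : R3)).hasTemperateGrowth
    simp only [SchwartzMap.lineDerivOp_apply_eq_fderiv] at this
    rw [← this]
    refine lintegral_congr fun ξ => ?_
    have h0 : inner ℝ ξ (EuclideanSpace.single j (1:ℝ) : R3) = ξ j := by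
      simp [EuclideanSpace.inner_single_right]
    rw [smul_apply, SchwartzMap.smulLeftCLM_apply_apply hg, h0]
    simp
  simp only [h1]
  rw [← lintegral_finsetSum']
  · refine lintegral_mono fun ξ => ?_
    have h2 : ‖ξ‖ₑ ^ 2 = ∑ j, ‖ξ j‖ₑ ^ 2 := by
      simp only [← ofReal_norm]
      simp only [← ENNReal.ofReal_pow (norm_nonneg _)]
      rw [← ENNReal.ofReal_sum_of_nonneg (fun _ _ => by positivity), EuclideanSpace.norm_sq_eq]
    rw [h2, Finset.sum_mul]
    refine Finset.sum_le_sum fun j _ => ?_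
    simp only [enorm_mul, mul_pow]
    have h3 : (1 : ℝ≥0∞) ≤ (‖(2:ℂ)‖ₑ ^ 2 * ‖(Real.pi : ℂ)‖ₑ ^ 2 * ‖Complex.I‖ₑ ^ 2) := by
      rw [← mul_pow, ← mul_pow, ← enorm_mul, ← enorm_mul, ← ofReal_norm]
      refine one_le_pow₀ ?_
      rw [ENNReal.one_le_ofReal]
      simp [abs_of_pos Real.pi_pos]
      linarith [Real.pi_gt_three]
    have h4 : ‖((ξ j : ℝ) : ℂ)‖ₑ = ‖ξ j‖ₑ := by
      simp [← ofReal_norm]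
    rw [h4]
    exact le_mul_of_one_le_left' h3
  · intro j _
    have : Continuous fun ξ => 𝓕 φ ξ := (𝓕 φ).continuous
    fun_prop

/-- Hölder with weights `1 - σ` and `σ`, after writing the integrand as `(|φ̂|²)^{1-σ}
(|ξ|²|φ̂|²)^σ`. The endpoints `σ = 0, 1` are included. -/
lemma weightedEnergy_fourier_le {σ : ℝ} (hσ : σ ∈ Icc (0 : ℝ) 1) (φ : 𝓢(R3, ℂ)) :
    weightedEnergy σ (𝓕 φ : 𝓢(R3, ℂ)) ≤ (∫⁻ x, ‖φ x‖ₑ ^ 2) ^ (1 - σ) *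
      (∑ j, ∫⁻ x, ‖fderiv ℝ φ x (EuclideanSpace.single j 1)‖ₑ ^ 2) ^ σ := by
  have hc : Continuous fun ξ => 𝓕 φ ξ := (𝓕 φ).continuous
  rw [← lintegral_enorm_sq_fourier]
  refine le_trans ?_ (mul_le_mul_right (ENNReal.rpow_le_rpow
    (lintegral_enorm_mul_fourier_le φ) hσ.1) _)
  refine le_trans (le_of_eq ?_) (ENNReal.lintegral_mul_norm_pow_le (by fun_prop) (by fun_prop)
    (sub_nonneg.2 hσ.2) hσ.1 (by ring))
  refine lintegral_congr fun ξ => ?_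
  rw [ENNReal.mul_rpow_of_nonneg _ _ hσ.1, ENNReal.rpow_mul, ENNReal.rpow_two, mul_left_comm,
    ← ENNReal.rpow_add_of_nonneg _ _ (sub_nonneg.2 hσ.2) hσ.1]
  simp

/-- `Represents` speaks only about test functions already known to lie in `sobolevBall`; this makes
that condition automatic, so that a representing functional can be evaluated on every test function.
-/
lemma mem_sobolevBall {σ : ℝ} (hσ : σ ∈ Icc (0 : ℝ) 1) {x : R3} {r : ℝ} (φ : 𝓢(R3, ℂ))
    (h : tsupport φ ⊆ Metric.ball x r) : (φ : 𝓢'(R3, ℂ)) ∈ sobolevBall σ x r := by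
  refine ⟨?_, fun y hy => ?_⟩
  · refine (homSobolevNorm_lt_top_iff σ _).2 ⟨_, hasFourierFunction_fourier φ, ?_⟩
    refine (weightedEnergy_fourier_le hσ φ).trans_lt ?_
    have key : ∀ ψ : 𝓢(R3, ℂ), ∫⁻ x, ‖ψ x‖ₑ ^ 2 < ⊤ := by
      intro ψ
      have := lintegral_rpow_enorm_lt_top_of_eLpNorm_lt_top (by norm_num) (by norm_num)
        (ψ.memLp 2 volume).2
      simpa using this
    refine ENNReal.mul_lt_top (ENNReal.rpow_lt_top_of_nonneg (sub_nonneg.2 hσ.2) (key φ).ne)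
      (ENNReal.rpow_lt_top_of_nonneg hσ.1 (ENNReal.sum_lt_top.2 fun j _ => ?_).ne)
    exact key (LineDeriv.lineDerivOp (EuclideanSpace.single j (1:ℝ) : R3) φ)
  · by_contra hn
    refine (Distribution.notMem_dsupport_iff y).2
      ⟨(Metric.closedBall x r)ᶜ, fun ψ hψ => ?_, Metric.isClosed_closedBall.isOpen_compl, hn⟩ hy
    rw [SchwartzMap.coe_apply]
    refine integral_eq_zero_of_ae (Filter.Eventually.of_forall fun z => ?_)
    by_cases hz : z ∈ Metric.closedBall x r
    · have : ψ z = 0 := image_eq_zero_of_notMem_tsupport fun h' => hψ h' hz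
      simp [this]
    · have : φ z = 0 := image_eq_zero_of_notMem_tsupport fun h' =>
        hz (Metric.ball_subset_closedBall (h h'))
      simp [this]

/-- A bounded functional represented by `f` satisfies an interpolation bound on test functions. -/
lemma enorm_integral_le_of_represents {σ : ℝ} (hσ : σ ∈ Icc (0 : ℝ) 1) {x : R3} {r : ℝ}
    {f : R3 → ℝ} {M : ℝ≥0} {T : sobolevBall σ x r →ₗ[ℂ] ℂ} (hT : IsBoundedFunctional T M)
    (hf : Represents T f) {φ : R3 → ℝ} (hφ : ContDiff ℝ ∞ φ)
    (hs : tsupport φ ⊆ Metric.ball x r) :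
    ‖∫ y in Metric.ball x r, f y * φ y‖ₑ ≤
      M * ((∫⁻ y, ‖φ y‖ₑ ^ 2) ^ ((1 - σ) / 2) * gradEnergy φ ^ (σ / 2)) := by
  have hc : HasCompactSupport φ :=
    HasCompactSupport.of_support_subset_isCompact (isCompact_closedBall x r)
      ((subset_tsupport φ).trans (hs.trans Metric.ball_subset_closedBall))
  have hc' : HasCompactSupport fun y => (φ y : ℂ) := hc.comp_left Complex.ofReal_zero
  set Φ : 𝓢(R3, ℂ) := hc'.toSchwartzMap (Complex.ofRealCLM.contDiff.comp hφ)
  have hΦ : ∀ y, Φ y = (φ y : ℂ) := fun y => rfl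
  have hsΦ : tsupport Φ ⊆ Metric.ball x r := by
    refine Subset.trans (closure_mono fun y hy => ?_) hs
    simpa [hΦ] using hy
  have hmem := mem_sobolevBall hσ Φ hsΦ
  have h1 := hf.2 Φ hsΦ hmem
  have h2 := hT ⟨_, hmem⟩
  rw [h1] at h2
  have h3 : ‖∫ y in Metric.ball x r, (f y : ℂ) * Φ y‖ₑ = ‖∫ y in Metric.ball x r, f y * φ y‖ₑ := by
    simp only [hΦ, ← Complex.ofReal_mul]
    rw [integral_complex_ofReal]
    simp [← ofReal_norm]
  rw [h3] at h2
  refine h2.trans (mul_le_mul_right ?_ _)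
  refine (iInf₂_le _ (hasFourierFunction_fourier Φ)).trans ?_
  refine (ENNReal.rpow_le_rpow (weightedEnergy_fourier_le hσ Φ) (by norm_num)).trans ?_
  have h4 : ∀ j y, ‖fderiv ℝ Φ y (EuclideanSpace.single j 1)‖ₑ = ‖pd j φ y‖ₑ := by
    intro j y
    have : HasFDerivAt (fun y => (φ y : ℂ)) (Complex.ofRealCLM.comp (fderiv ℝ φ y)) y :=
      Complex.ofRealCLM.hasFDerivAt.comp y
        (hφ.differentiable (by simp)).differentiableAt.hasFDerivAt
    have h5 : fderiv ℝ Φ y = Complex.ofRealCLM.comp (fderiv ℝ φ y) := this.fderiv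
    rw [h5]
    simp [pd, ← ofReal_norm]
  have h6 : ∀ y, ‖Φ y‖ₑ = ‖φ y‖ₑ := fun y => by simp [hΦ, ← ofReal_norm]
  simp only [h4, h6]
  rw [ENNReal.mul_rpow_of_nonneg _ _ (by norm_num), ← ENNReal.rpow_mul, ← ENNReal.rpow_mul,
    mul_one_div, mul_one_div]
  rfl

/-! ### Mollification and Sobolev embedding for compactly supported `W^{1,2}` functions -/

open scoped Convolution

/-- `g` is the weak gradient of `v` on the whole space. -/
def HasWeakGrad (v : R3 → ℝ) (g : Fin 3 → R3 → ℝ) : Prop :=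
  ∀ φ : R3 → ℝ, ContDiff ℝ ∞ φ → HasCompactSupport φ →
    ∀ j, ∫ x, v x * pd j φ x = - ∫ x, g j x * φ x

/-- The convolution of `v` with a bump function of integral one. -/
noncomputable def mollify (η : ContDiffBump (0 : R3)) (v : R3 → ℝ) : R3 → ℝ :=
  η.normed volume ⋆[ContinuousLinearMap.lsmul ℝ ℝ, volume] v

lemma mollify_apply (η : ContDiffBump (0 : R3)) (v : R3 → ℝ) (x : R3) :
    mollify η v x = ∫ t, η.normed volume (x - t) * v t := by
  rw [mollify, convolution_eq_swap]
  rfl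

lemma lintegral_enorm_normed (η : ContDiffBump (0 : R3)) :
    ∫⁻ x, ‖η.normed volume x‖ₑ = 1 := by
  have h := η.integral_normed (μ := (volume : Measure R3))
  have h2 := ofReal_integral_eq_lintegral_ofReal (η.integrable_normed (μ := (volume : Measure R3)))
    (Filter.Eventually.of_forall fun x => η.nonneg_normed x)
  rw [h, ENNReal.ofReal_one] at h2
  rw [h2]
  exact lintegral_congr fun x => Real.enorm_of_nonneg (η.nonneg_normed x)

lemma continuous_normed (η : ContDiffBump (0 : R3)) :
    Continuous (η.normed (volume : Measure R3)) :=
  (η.contDiff_normed (n := 0)).continuous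

/-- Cauchy–Schwarz for the probability density `t ↦ η(x - t)` bounds the square pointwise by the
average of `v²`; Tonelli in `x` then finishes. -/
lemma lintegral_mollify_sq_le (η : ContDiffBump (0 : R3)) {v : R3 → ℝ} (hv : MemLp v 2) :
    ∫⁻ x, ‖mollify η v x‖ₑ ^ 2 ≤ ∫⁻ x, ‖v x‖ₑ ^ 2 := by
  have hc := continuous_normed η
  have hvm := hv.1.enorm
  have h1 : ∀ x, ‖mollify η v x‖ₑ ^ 2 ≤
      ∫⁻ t, ‖η.normed volume (x - t)‖ₑ * ‖v t‖ₑ ^ 2 := by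
    intro x
    have hx1 : ∫⁻ t, ‖η.normed volume (x - t)‖ₑ = 1 := by
      rw [lintegral_sub_left_eq_self (fun t => ‖η.normed (volume : Measure R3) t‖ₑ) x]
      exact lintegral_enorm_normed η
    -- The splitting `η|v| = η^{1/2} (η v²)^{1/2}` prepares Cauchy–Schwarz.
    have hx2 : ‖mollify η v x‖ₑ ≤ ∫⁻ t, ‖η.normed volume (x - t)‖ₑ ^ (1 / 2 : ℝ) *
        (‖η.normed volume (x - t)‖ₑ * ‖v t‖ₑ ^ 2) ^ (1 / 2 : ℝ) := by
      rw [mollify_apply]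
      refine (enorm_integral_le_lintegral_enorm _).trans (le_of_eq (lintegral_congr fun t => ?_))
      rw [ENNReal.mul_rpow_of_nonneg _ _ (by norm_num), ← mul_assoc,
        ← ENNReal.rpow_add_of_nonneg _ _ (by norm_num) (by norm_num), ← ENNReal.rpow_natCast,
        ← ENNReal.rpow_mul, enorm_mul]
      norm_num
    have hx3 := hx2.trans (ENNReal.lintegral_mul_norm_pow_le (by fun_prop) (by fun_prop)
      (by norm_num) (by norm_num) (by norm_num))
    rw [hx1, ENNReal.one_rpow, one_mul] at hx3
    refine (pow_le_pow_left' hx3 2).trans (le_of_eq ?_)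
    rw [← ENNReal.rpow_natCast, ← ENNReal.rpow_mul]
    norm_num
  refine (lintegral_mono h1).trans ?_
  rw [lintegral_lintegral_swap]
  · refine le_of_eq (lintegral_congr fun t => ?_)
    have hct : Continuous fun x => η.normed (volume : Measure R3) (x - t) := by fun_prop
    rw [lintegral_mul_const _ hct.measurable.enorm,
      lintegral_sub_right_eq_self (fun x => ‖η.normed (volume : Measure R3) x‖ₑ) t,
      lintegral_enorm_normed, one_mul]
  · have h2 : AEMeasurable (fun z : R3 × R3 => ‖v z.2‖ₑ) (volume.prod volume) := hvm.comp_snd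
    have h3 : Continuous (fun z : R3 × R3 => η.normed volume (z.1 - z.2)) := by fun_prop
    exact h3.measurable.enorm.aemeasurable.mul (h2.pow_const 2)

lemma contDiff_mollify (η : ContDiffBump (0 : R3)) {v : R3 → ℝ} (hv : LocallyIntegrable v) :
    ContDiff ℝ ∞ (mollify η v) :=
  η.hasCompactSupport_normed.contDiff_convolution_left _ η.contDiff_normed hv

/-- The derivative falls on the bump; testing the weak gradient against `t ↦ η(x - t)` moves it to
`v`. The sign of the weak gradient cancels the one from reflecting the bump. -/
lemma pd_mollify (η : ContDiffBump (0 : R3)) {v : R3 → ℝ} {g : Fin 3 → R3 → ℝ}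
    (hv : LocallyIntegrable v) (hg : HasWeakGrad v g) (j : Fin 3) :
    pd j (mollify η v) = mollify η (g j) := by
  funext x
  have hη : ContDiff ℝ ∞ (η.normed (volume : Measure R3)) := η.contDiff_normed
  have hcη := η.hasCompactSupport_normed (μ := (volume : Measure R3))
  have h1 : mollify η v = v ⋆[(ContinuousLinearMap.lsmul ℝ ℝ).flip, volume] η.normed volume := by
    rw [mollify, ← convolution_flip]
  have h2 := hcη.hasFDerivAt_convolution_right
    ((ContinuousLinearMap.lsmul ℝ ℝ).flip : ℝ →L[ℝ] ℝ →L[ℝ] ℝ) hv (hη.of_le (by simp)) x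
  rw [← h1] at h2
  rw [pd, h2.fderiv, convolution_precompR_apply _ hv (hcη.fderiv ℝ)
    (hη.continuous_fderiv (by simp)), convolution_def]
  set ψ : R3 → ℝ := fun t => η.normed volume (x - t) with hψ
  have hψd : ContDiff ℝ ∞ ψ := hη.comp (contDiff_const.sub contDiff_id)
  have hψc : HasCompactSupport ψ := by
    have := hcη.comp_homeomorph (Homeomorph.subLeft x)
    exact this
  have h3 := hg ψ hψd hψc j
  have h4 : ∀ t, pd j ψ t = -fderiv ℝ (η.normed volume) (x - t) (EuclideanSpace.single j 1) := by
    intro t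
    have : HasFDerivAt ψ ((fderiv ℝ (η.normed volume) (x - t)).comp
        (-ContinuousLinearMap.id ℝ R3)) t :=
      HasFDerivAt.comp t (hη.differentiable (by simp)).differentiableAt.hasFDerivAt
        ((hasFDerivAt_id t).const_sub x)
    rw [pd, this.fderiv]
    simp
  rw [mollify_apply]
  simp only [h4, mul_neg, integral_neg, neg_inj] at h3
  simp only [ContinuousLinearMap.flip_apply, ContinuousLinearMap.lsmul_apply, smul_eq_mul]
  simp only [mul_comm (v _)] at h3
  rw [h3]
  exact integral_congr_ae (Filter.Eventually.of_forall fun t => mul_comm _ _)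

lemma tsupport_mollify_subset (η : ContDiffBump (0 : R3)) {v : R3 → ℝ} {x₀ : R3} {ρ : ℝ}
    (hv : ∀ x ∉ Metric.closedBall x₀ ρ, v x = 0) :
    tsupport (mollify η v) ⊆ Metric.closedBall x₀ (ρ + η.rOut) := by
  refine closure_minimal ?_ Metric.isClosed_closedBall
  refine (support_convolution_subset _).trans ?_
  rintro _ ⟨a, ha, b, hb, rfl⟩
  have ha' : ‖a‖ < η.rOut := by
    have : a ∈ Function.support (η.normed (volume : Measure R3)) := ha
    rw [η.support_normed_eq] at this
    simpa using this
  have hb' : dist b x₀ ≤ ρ := by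
    by_contra h
    exact hb (hv b h)
  rw [Metric.mem_closedBall]
  calc dist (a + b) x₀ ≤ dist (a + b) b + dist b x₀ := dist_triangle _ _ _
    _ ≤ ρ + η.rOut := by
      have : dist (a + b) b = ‖a‖ := by simp [dist_eq_norm]
      linarith

/-- Mollification: a compactly supported `W^{1,2}` function is the almost everywhere limit of test
functions with no larger norms. -/
lemma exists_smooth_approx {v : R3 → ℝ} {g : Fin 3 → R3 → ℝ} {x₀ : R3} {ρ ρ' : ℝ} (hρ : ρ < ρ')
    (hv : MemLp v 2) (hg : ∀ j, MemLp (g j) 2) (hvg : HasWeakGrad v g)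
    (hs : ∀ x ∉ Metric.closedBall x₀ ρ, v x = 0) :
    ∃ V : ℕ → R3 → ℝ, (∀ n, ContDiff ℝ ∞ (V n)) ∧
      (∀ n, tsupport (V n) ⊆ Metric.closedBall x₀ ρ') ∧
      (∀ n, ∫⁻ x, ‖V n x‖ₑ ^ 2 ≤ ∫⁻ x, ‖v x‖ₑ ^ 2) ∧
      (∀ n, gradEnergy (V n) ≤ ∑ j, ∫⁻ x, ‖g j x‖ₑ ^ 2) ∧
      ∀ᵐ x, Filter.Tendsto (fun n => V n x) Filter.atTop (𝓝 (v x)) := by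
  have hloc : LocallyIntegrable v := hv.locallyIntegrable (by norm_num)
  have hpos : ∀ n : ℕ, 0 < (ρ' - ρ) / (n + 1) := fun n => div_pos (by linarith) (by positivity)
  -- Outer radii tend to zero and never exceed `ρ' - ρ`, which keeps supports in the larger ball.
  -- The fixed ratio 2 of the radii is what almost everywhere convergence by Lebesgue
  -- differentiation requires.
  let η : ℕ → ContDiffBump (0 : R3) := fun n =>
    ⟨(ρ' - ρ) / (n + 1) / 2, (ρ' - ρ) / (n + 1), half_pos (hpos n), half_lt_self (hpos n)⟩
  refine ⟨fun n => mollify (η n) v, fun n => contDiff_mollify _ hloc, fun n => ?_,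
    fun n => lintegral_mollify_sq_le _ hv, fun n => ?_, ?_⟩
  · refine (tsupport_mollify_subset (η n) hs).trans (Metric.closedBall_subset_closedBall ?_)
    have : (ρ' - ρ) / (n + 1) ≤ ρ' - ρ := div_le_self (by linarith) (by simp)
    change ρ + (ρ' - ρ) / (n + 1) ≤ ρ'
    linarith
  · refine Finset.sum_le_sum fun j _ => ?_
    rw [pd_mollify _ hloc hvg]
    exact lintegral_mollify_sq_le _ (hg j)
  · refine ContDiffBump.ae_convolution_tendsto_right_of_locallyIntegrable (K := 2) ?_ ?_ hloc
    · have := (tendsto_const_div_atTop_nhds_zero_nat (ρ' - ρ)).comp (Filter.tendsto_add_atTop_nat 1)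
      refine this.congr fun n => ?_
      simp [η]
    · refine Filter.Eventually.of_forall fun n => ?_
      change (ρ' - ρ) / (n + 1) ≤ 2 * ((ρ' - ρ) / (n + 1) / 2)
      linarith

lemma enorm_fderiv_sq_le (f : R3 → ℝ) (x : R3) :
    ‖fderiv ℝ f x‖ₑ ^ 2 ≤ ∑ j, ‖pd j f x‖ₑ ^ 2 := by
  have h : ‖fderiv ℝ f x‖ ≤ √(∑ j, ‖pd j f x‖ ^ 2) := by
    refine ContinuousLinearMap.opNorm_le_bound _ (Real.sqrt_nonneg _) fun y => ?_
    have hy : fderiv ℝ f x y = ∑ j, y j * pd j f x := by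
      conv_lhs => rw [← (EuclideanSpace.basisFun (Fin 3) ℝ).sum_repr y]
      simp [pd]
    rw [hy, EuclideanSpace.norm_eq, mul_comm]
    refine (abs_le.2 ⟨?_, ?_⟩)
    · have := Real.sum_mul_le_sqrt_mul_sqrt Finset.univ (fun j => -y j) (fun j => pd j f x)
      simp only [neg_mul, Finset.sum_neg_distrib, neg_sq] at this
      simp only [Real.norm_eq_abs, sq_abs]
      linarith
    · simpa only [Real.norm_eq_abs, sq_abs] using
        Real.sum_mul_le_sqrt_mul_sqrt Finset.univ (fun j => y j) (fun j => pd j f x)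
  have h2 : ‖fderiv ℝ f x‖ ^ 2 ≤ ∑ j, ‖pd j f x‖ ^ 2 := by
    refine (pow_le_pow_left₀ (norm_nonneg _) h 2).trans (le_of_eq (Real.sq_sqrt ?_))
    positivity
  have h3 := ENNReal.ofReal_le_ofReal h2
  rw [ENNReal.ofReal_sum_of_nonneg (fun _ _ => by positivity)] at h3
  simpa only [ENNReal.ofReal_pow (norm_nonneg _), ofReal_norm] using h3

/-- The Sobolev inequality on a ball, for test functions. -/
lemma exists_eLpNorm_three_le (x₀ : R3) (ρ : ℝ) :
    ∃ C : ℝ≥0, ∀ V : R3 → ℝ, ContDiff ℝ ∞ V → tsupport V ⊆ Metric.closedBall x₀ ρ →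
      eLpNorm V 3 volume ≤ C * gradEnergy V ^ (1 / 2 : ℝ) := by
  refine ⟨eLpNormLESNormFDerivOfLeConst ℝ volume (Metric.closedBall x₀ ρ) 2 3, fun V hV hs => ?_⟩
  have h1 := eLpNorm_le_eLpNorm_fderiv_of_le (volume : Measure R3) (p := 2) (q := 3)
    (hV.of_le (by simp)) ((subset_tsupport V).trans hs) (by norm_num)
    (by simp [finrank_euclideanSpace]; norm_num) (by simp [finrank_euclideanSpace]; norm_num)
    Metric.isBounded_closedBall
  refine h1.trans (mul_le_mul_right ?_ _)
  rw [eLpNorm_nnreal_eq_lintegral (by norm_num)]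
  simp only [NNReal.coe_ofNat]
  refine ENNReal.rpow_le_rpow ?_ (by norm_num)
  have hm : ∀ j : Fin 3, Measurable (fun x => ‖pd j V x‖ₑ ^ 2) := fun j => by
    have : Continuous (pd j V) := (hV.continuous_fderiv (by simp)).clm_apply continuous_const
    exact this.measurable.enorm.pow_const 2
  rw [gradEnergy, ← lintegral_finsetSum _ (fun j _ => hm j)]
  refine lintegral_mono fun x => ?_
  simp only [ENNReal.rpow_two]
  exact enorm_fderiv_sq_le V x

/-- Mollifications are bounded in `L³` by the Sobolev inequality on a slightly larger ball, and the
bound survives the almost everywhere limit by Fatou. -/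
lemma memLp_three_of_hasWeakGrad {v : R3 → ℝ} {g : Fin 3 → R3 → ℝ} {x₀ : R3} {ρ : ℝ}
    (hv : MemLp v 2) (hg : ∀ j, MemLp (g j) 2) (hvg : HasWeakGrad v g)
    (hs : ∀ x ∉ Metric.closedBall x₀ ρ, v x = 0) : MemLp v 3 := by
  obtain ⟨V, hV, hVs, -, hVg, hlim⟩ := exists_smooth_approx (lt_add_one ρ) hv hg hvg hs
  obtain ⟨C, hC⟩ := exists_eLpNorm_three_le x₀ (ρ + 1)
  refine ⟨hv.1, ?_⟩
  have h1 := Lp.eLpNorm_lim_le_liminf_eLpNorm (p := 3)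
    (fun n => ((hV n).continuous.aestronglyMeasurable : AEStronglyMeasurable (V n) volume)) v hlim
  have h2 : ∀ n, eLpNorm (V n) 3 volume ≤ C * (∑ j, ∫⁻ x, ‖g j x‖ₑ ^ 2) ^ (1 / 2 : ℝ) :=
    fun n => (hC _ (hV n) (hVs n)).trans
      (mul_le_mul_right (ENNReal.rpow_le_rpow (hVg n) (by norm_num)) _)
  refine (h1.trans (Filter.liminf_le_of_le (by isBoundedDefault) fun b hb => ?_)).trans_lt
    (b := C * (∑ j, ∫⁻ x, ‖g j x‖ₑ ^ 2) ^ (1 / 2 : ℝ)) ?_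
  · obtain ⟨n, hn⟩ := hb.exists
    exact hn.trans (h2 n)
  · refine ENNReal.mul_lt_top (by simp) (ENNReal.rpow_lt_top_of_nonneg (by norm_num)
      (ENNReal.sum_lt_top.2 fun j _ => ?_).ne)
    simpa using lintegral_rpow_enorm_lt_top_of_eLpNorm_lt_top (by norm_num) (by norm_num) (hg j).2

/-! ### The dual pairing with `W^{1,2}` multipliers -/

/-- Vitali's theorem: by Hölder, the `L¹` norm of `f V_n` on a small set is at most `K` times the
`L^{3/2}` norm of `f` there. The products are thus uniformly integrable although `V_n` is only
bounded in `L³`. -/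
lemma tendsto_integral_mul_of_bounded {μ : Measure R3} [IsFiniteMeasure μ] {f v : R3 → ℝ}
    {V : ℕ → R3 → ℝ} (hf : MemLp f (3 / 2) μ) (hV : ∀ n, AEStronglyMeasurable (V n) μ)
    (hv : MemLp v 3 μ) {K : ℝ≥0∞} (hK : K ≠ ⊤) (hb : ∀ n, eLpNorm (V n) 3 μ ≤ K)
    (hlim : ∀ᵐ x ∂μ, Filter.Tendsto (fun n => V n x) Filter.atTop (𝓝 (v x))) :
    Filter.Tendsto (fun n => ∫ x, f x * V n x ∂μ) Filter.atTop (𝓝 (∫ x, f x * v x ∂μ)) := by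
  have : ENNReal.HolderTriple (3 / 2) 3 1 := ⟨by
    rw [ENNReal.inv_div (by simp) (by simp), inv_one, ← one_div, ENNReal.div_add_div_same]
    norm_num
    exact ENNReal.div_self (by norm_num) (by norm_num)⟩
  have hbound : ∀ (h w : R3 → ℝ), AEStronglyMeasurable h μ → AEStronglyMeasurable w μ →
      eLpNorm (fun x => h x * w x) 1 μ ≤ eLpNorm h (3 / 2) μ * eLpNorm w 3 μ :=
    fun h w hh hw => by
      have := eLpNorm_smul_le_mul_eLpNorm (p := 3 / 2) (q := 3) (r := 1) (f := w) (φ := h) hw hh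
      exact this
  have hmem : ∀ w, MemLp w 3 μ → MemLp (fun x => f x * w x) 1 μ := fun w hw =>
    ⟨hf.1.mul hw.1, (hbound _ _ hf.1 hw.1).trans_lt (ENNReal.mul_lt_top hf.2 hw.2)⟩
  have hVm : ∀ n, MemLp (V n) 3 μ := fun n => ⟨hV n, (hb n).trans_lt hK.lt_top⟩
  refine tendsto_integral_of_L1' _ (hf.1.mul hv.1)
    (Filter.Eventually.of_forall fun n => memLp_one_iff_integrable.1 (hmem _ (hVm n))) ?_
  refine tendsto_Lp_finite_of_tendsto_ae le_rfl (by simp) (fun n => hf.1.mul (hV n)) (hmem v hv)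
    ?_ ?_
  · intro ε hε
    -- The added 1 keeps the quotient meaningful when `K = 0`.
    obtain ⟨δ, hδ, h⟩ := hf.eLpNorm_indicator_le
      (by rw [ENNReal.le_div_iff_mul_le (by simp) (by simp)]; norm_num)
      (ENNReal.div_ne_top (by simp) (by simp)) (ε := ε / (K.toReal + 1)) (by positivity)
    refine ⟨δ, hδ, fun n s hs hμs => ?_⟩
    have e : s.indicator (fun x => f x * V n x) = fun x => s.indicator f x * V n x := by
      funext x
      by_cases hx : x ∈ s <;> simp [hx]
    rw [e]
    refine (hbound _ _ (hf.1.indicator hs) (hV n)).trans ?_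
    refine (mul_le_mul' (h s hs hμs) (hb n)).trans ?_
    rw [← ENNReal.ofReal_toReal hK, ← ENNReal.ofReal_mul (by positivity)]
    refine ENNReal.ofReal_le_ofReal ?_
    rw [ENNReal.toReal_ofReal (by positivity), div_mul_eq_mul_div, div_le_iff₀ (by positivity)]
    nlinarith
  · filter_upwards [hlim] with x hx
    exact hx.const_mul _

/-- The bound holds for the mollifications of `v`, with constants that do not grow, and passes to
the limit in the integral; the value of `T` at `v` itself is never needed. The gap between `ρ` and
`ρ'` makes room for the mollified supports. -/
lemma enorm_integral_le_of_hasWeakGrad {σ : ℝ} (hσ : σ ∈ Icc (0 : ℝ) 1) {x₀ : R3} {r ρ ρ' : ℝ}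
    (hρ : ρ < ρ') (hr : ρ' < r)
    {f : R3 → ℝ} {M : ℝ≥0} {T : sobolevBall σ x₀ r →ₗ[ℂ] ℂ} (hT : IsBoundedFunctional T M)
    (hf : Represents T f) (hfm : MemLp f (3 / 2) (volume.restrict (Metric.closedBall x₀ ρ')))
    {v : R3 → ℝ} {g : Fin 3 → R3 → ℝ}
    (hv : MemLp v 2) (hg : ∀ j, MemLp (g j) 2) (hvg : HasWeakGrad v g)
    (hs : ∀ x ∉ Metric.closedBall x₀ ρ, v x = 0) :
    ‖∫ y in Metric.ball x₀ r, f y * v y‖ₑ ≤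
      M * ((∫⁻ y, ‖v y‖ₑ ^ 2) ^ ((1 - σ) / 2) * (∑ j, ∫⁻ x, ‖g j x‖ₑ ^ 2) ^ (σ / 2)) := by
  obtain ⟨V, hV, hVs, hV2, hVg, hlim⟩ := exists_smooth_approx hρ hv hg hvg hs
  obtain ⟨C, hC⟩ := exists_eLpNorm_three_le x₀ ρ'
  have hsub : Metric.closedBall x₀ ρ' ⊆ Metric.ball x₀ r := Metric.closedBall_subset_ball hr
  have hres : ∀ w : R3 → ℝ, (∀ x ∉ Metric.closedBall x₀ ρ', w x = 0) →
      ∫ y in Metric.ball x₀ r, f y * w y = ∫ y in Metric.closedBall x₀ ρ', f y * w y := by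
    intro w hw
    refine setIntegral_eq_of_subset_of_forall_sdiff_eq_zero measurableSet_ball hsub fun x hx => ?_
    rw [hw x hx.2, mul_zero]
  have : IsFiniteMeasure ((volume : Measure R3).restrict (Metric.closedBall x₀ ρ')) :=
    isFiniteMeasure_restrict.2 (isCompact_closedBall x₀ ρ').measure_lt_top.ne
  have hlim' := tendsto_integral_mul_of_bounded hfm
    (K := C * (∑ j, ∫⁻ x, ‖g j x‖ₑ ^ 2) ^ (1 / 2 : ℝ)) (V := V)
    (fun n => (hV n).continuous.aestronglyMeasurable)
    ((memLp_three_of_hasWeakGrad hv hg hvg hs).restrict _) ?_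
    (fun n => (eLpNorm_mono_measure _ Measure.restrict_le_self).trans
      ((hC _ (hV n) (hVs n)).trans
      (mul_le_mul_right (ENNReal.rpow_le_rpow (hVg n) (by norm_num)) _)))
    (ae_restrict_of_ae hlim)
  · rw [hres v fun x hx => hs x fun h => hx (Metric.closedBall_subset_closedBall hρ.le h)]
    refine le_of_tendsto hlim'.enorm (Filter.Eventually.of_forall fun n => ?_)
    rw [← hres (V n) fun x hx => image_eq_zero_of_notMem_tsupport fun h => hx (hVs n h)]
    refine (enorm_integral_le_of_represents hσ hT hf (hV n) ((hVs n).trans hsub)).trans ?_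
    refine mul_le_mul_right (mul_le_mul' (ENNReal.rpow_le_rpow (hV2 n) ?_)
      (ENNReal.rpow_le_rpow (hVg n) ?_)) _
    · linarith [hσ.2]
    · linarith [hσ.1]
  · refine (ENNReal.mul_lt_top (by simp) (ENNReal.rpow_lt_top_of_nonneg (by norm_num)
      (ENNReal.sum_lt_top.2 fun j _ => ?_).ne)).ne
    simpa using lintegral_rpow_enorm_lt_top_of_eLpNorm_lt_top (by norm_num) (by norm_num) (hg j).2

/-- The pairing of a function with a compactly supported `W^{1,2}` function is bounded by the dual
norm, with an interpolated bound for the homogeneous Sobolev norm. -/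
lemma enorm_integral_le_dualNorm_mul {σ : ℝ} (hσ : σ ∈ Icc (0 : ℝ) 1) {x₀ : R3} {r ρ ρ' : ℝ}
    (hρ : ρ < ρ') (hr : ρ' < r) {f : R3 → ℝ}
    (hfm : MemLp f (3 / 2) (volume.restrict (Metric.closedBall x₀ ρ')))
    {v : R3 → ℝ} {g : Fin 3 → R3 → ℝ}
    (hv : MemLp v 2) (hg : ∀ j, MemLp (g j) 2) (hvg : HasWeakGrad v g)
    (hs : ∀ x ∉ Metric.closedBall x₀ ρ, v x = 0) {a b : ℝ≥0∞} (ha : a ≠ 0) (ha' : a ≠ ⊤)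
    (hb : b ≠ 0) (hb' : b ≠ ⊤) (hva : ∫⁻ y, ‖v y‖ₑ ^ 2 ≤ a) (hgb : ∑ j, ∫⁻ x, ‖g j x‖ₑ ^ 2 ≤ b) :
    ‖∫ y in Metric.ball x₀ r, f y * v y‖ₑ ≤
      dualNorm σ x₀ r f * (a ^ ((1 - σ) / 2) * b ^ (σ / 2)) := by
  have h1 : 0 ≤ (1 - σ) / 2 := by linarith [hσ.2]
  have h2 : 0 ≤ σ / 2 := by linarith [hσ.1]
  have hne : a ^ ((1 - σ) / 2) * b ^ (σ / 2) ≠ 0 :=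
    mul_ne_zero (ENNReal.rpow_pos (pos_iff_ne_zero.2 ha) ha').ne'
      (ENNReal.rpow_pos (pos_iff_ne_zero.2 hb) hb').ne'
  have hne' : a ^ ((1 - σ) / 2) * b ^ (σ / 2) ≠ ⊤ :=
    ENNReal.mul_ne_top (ENNReal.rpow_ne_top_of_nonneg h1 ha')
      (ENNReal.rpow_ne_top_of_nonneg h2 hb')
  -- Dividing by a nonzero finite factor reduces the claim to each admissible `M` in the infimum.
  -- With no admissible `M` the infimum is `⊤` and nothing remains to be shown; nonvanishing of the
  -- factor excludes `⊤ * 0`.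
  rw [dualNorm, ← ENNReal.div_le_iff hne hne']
  refine le_iInf₂ fun M hM => ?_
  obtain ⟨T, hT, hf⟩ := hM
  rw [ENNReal.div_le_iff hne hne']
  refine (enorm_integral_le_of_hasWeakGrad hσ hρ hr hT hf hfm hv hg hvg hs).trans ?_
  exact mul_le_mul_right (mul_le_mul' (ENNReal.rpow_le_rpow hva h1) (ENNReal.rpow_le_rpow hgb h2)) _

/-! ### Products with cutoffs and their weak gradients -/

lemma continuous_pd {φ : R3 → ℝ} (h : ContDiff ℝ ∞ φ) (j : Fin 3) : Continuous (pd j φ) :=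
  (h.continuous_fderiv (by simp)).clm_apply continuous_const

lemma contDiff_pd {φ : R3 → ℝ} (h : ContDiff ℝ ∞ φ) (j : Fin 3) : ContDiff ℝ ∞ (pd j φ) :=
  (h.fderiv_right (m := ∞) (by simp)).clm_apply contDiff_const

lemma tsupport_pd_subset (φ : R3 → ℝ) (j : Fin 3) : tsupport (pd j φ) ⊆ tsupport φ := by
  refine closure_minimal (fun x hx => ?_) (isClosed_tsupport φ)
  refine support_fderiv_subset ℝ (f := φ) fun h => hx ?_
  rw [pd, h]
  rfl

lemma pd_mul {φ ψ : R3 → ℝ} (hφ : ContDiff ℝ ∞ φ) (hψ : ContDiff ℝ ∞ ψ) (j : Fin 3) (x : R3) :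
    pd j (fun y => φ y * ψ y) x = φ x * pd j ψ x + pd j φ x * ψ x := by
  have h : HasFDerivAt (fun y => φ y * ψ y) (φ x • fderiv ℝ ψ x + ψ x • fderiv ℝ φ x) x :=
    (hφ.differentiable (by simp)).differentiableAt.hasFDerivAt.mul
      (hψ.differentiable (by simp)).differentiableAt.hasFDerivAt
  rw [pd, h.fderiv]
  simp [pd, mul_comm]

lemma memLp_mul_of_tsupport_subset {Ω : Set R3} (hΩ : MeasurableSet Ω) {ζ v : R3 → ℝ} {p : ℝ≥0∞}
    (hζ : Continuous ζ) (hc : HasCompactSupport ζ) (hs : tsupport ζ ⊆ Ω)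
    (hv : MemLp v p (volume.restrict Ω)) : MemLp (fun x => ζ x * v x) p := by
  have e : (fun x => ζ x * v x) = Ω.indicator (fun x => ζ x * v x) := by
    funext x
    by_cases hx : x ∈ Ω
    · rw [indicator_of_mem hx]
    · rw [indicator_of_notMem hx, image_eq_zero_of_notMem_tsupport fun h => hx (hs h), zero_mul]
  rw [e, memLp_indicator_iff_restrict hΩ]
  obtain ⟨C, hC⟩ := hζ.bounded_above_of_compact_support hc
  refine hv.of_le_mul (c := C) (hζ.aestronglyMeasurable.mul hv.1)
    (Filter.Eventually.of_forall fun x => ?_)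
  rw [norm_mul]
  exact mul_le_mul_of_nonneg_right (hC x) (norm_nonneg _)

/-- Test the local weak gradient with `ζφ`, which is supported in `Ω` whatever the support of `φ`.
Multiplication by `ζ` thus turns a weak gradient on `Ω` into one on the whole space. -/
lemma hasWeakGrad_mul {Ω : Set R3} {ζ v : R3 → ℝ} {h : Fin 3 → R3 → ℝ}
    (hζ : ContDiff ℝ ∞ ζ) (hc : HasCompactSupport ζ) (hs : tsupport ζ ⊆ Ω)
    (hv : MemLp v 2 (volume.restrict Ω)) (hh : ∀ j, MemLp (h j) 2 (volume.restrict Ω))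
    (hvh : ∀ φ : R3 → ℝ, ContDiff ℝ ∞ φ → HasCompactSupport φ → tsupport φ ⊆ Ω →
      ∀ j, ∫ x in Ω, v x * pd j φ x = - ∫ x in Ω, h j x * φ x) :
    HasWeakGrad (fun x => ζ x * v x) (fun j x => ζ x * h j x + pd j ζ x * v x) := by
  intro φ hφ hcφ j
  have h0 : ∀ x ∉ Ω, ζ x = 0 := fun x hx => image_eq_zero_of_notMem_tsupport fun h => hx (hs h)
  have h0' : ∀ x ∉ Ω, pd j ζ x = 0 := fun x hx =>
    image_eq_zero_of_notMem_tsupport fun h => hx (hs (tsupport_pd_subset ζ j h))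
  have key : ∀ (ψ w : R3 → ℝ), Continuous ψ → HasCompactSupport ψ →
      MemLp w 2 (volume.restrict Ω) → Integrable (fun x => w x * ψ x) (volume.restrict Ω) := by
    intro ψ w hψ hcψ hw
    have hψ2 : MemLp ψ 2 := hψ.memLp_of_hasCompactSupport hcψ
    exact hw.integrable_mul (hψ2.restrict Ω)
  have h1 := hvh (fun x => ζ x * φ x) (hζ.mul hφ) hc.mul_right
    (closure_minimal ((Function.support_mul_subset_left ζ φ).trans (subset_tsupport ζ))
      (isClosed_tsupport ζ) |>.trans hs) j
  simp only [pd_mul hζ hφ] at h1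
  have i1 := key (fun x => ζ x * pd j φ x) v (hζ.continuous.mul (continuous_pd hφ j)) hc.mul_right hv
  have i2 := key (fun x => pd j ζ x * φ x) v ((continuous_pd hζ j).mul hφ.continuous)
    hcφ.mul_left hv
  have i3 := key (fun x => ζ x * φ x) (h j) (hζ.continuous.mul hφ.continuous) hc.mul_right (hh j)
  have e1 : ∫ x in Ω, v x * (ζ x * pd j φ x + pd j ζ x * φ x) =
      (∫ x in Ω, v x * (ζ x * pd j φ x)) + ∫ x in Ω, v x * (pd j ζ x * φ x) := by
    rw [← integral_add i1 i2]
    simp only [mul_add]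
  have e2 : ∫ x in Ω, (ζ x * h j x + pd j ζ x * v x) * φ x =
      (∫ x in Ω, h j x * (ζ x * φ x)) + ∫ x in Ω, v x * (pd j ζ x * φ x) := by
    rw [← integral_add i3 i2]
    exact integral_congr_ae (Filter.Eventually.of_forall fun x => by ring)
  have e3 : ∫ x in Ω, ζ x * v x * pd j φ x = ∫ x in Ω, v x * (ζ x * pd j φ x) :=
    integral_congr_ae (Filter.Eventually.of_forall fun x => by ring)
  rw [e1] at h1
  have e4 : ∫ x in Ω, ζ x * v x * pd j φ x = ∫ x, ζ x * v x * pd j φ x :=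
    setIntegral_eq_integral_of_forall_compl_eq_zero fun x hx => by simp [h0 x hx]
  have e5 : ∫ x in Ω, (ζ x * h j x + pd j ζ x * v x) * φ x =
      ∫ x, (ζ x * h j x + pd j ζ x * v x) * φ x :=
    setIntegral_eq_integral_of_forall_compl_eq_zero fun x hx => by simp [h0 x hx, h0' x hx]
  rw [← e4, ← e5, e2, e3]
  linarith

lemma HasWeakGrad.sum {ι : Type*} (s : Finset ι) {v : ι → R3 → ℝ} {g : ι → Fin 3 → R3 → ℝ}
    (hv : ∀ i ∈ s, MemLp (v i) 2) (hg : ∀ i ∈ s, ∀ j, MemLp (g i j) 2)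
    (h : ∀ i ∈ s, HasWeakGrad (v i) (g i)) :
    HasWeakGrad (fun x => ∑ i ∈ s, v i x) (fun j x => ∑ i ∈ s, g i j x) := by
  intro φ hφ hc j
  have h1 : MemLp φ 2 := hφ.continuous.memLp_of_hasCompactSupport hc
  have h2 : MemLp (pd j φ) 2 := (continuous_pd hφ j).memLp_of_hasCompactSupport
    (hc.mono' ((subset_tsupport _).trans (tsupport_pd_subset φ j)))
  simp only [Finset.sum_mul]
  have i1 : ∀ i ∈ s, Integrable (fun x => v i x * pd j φ x) := fun i hi =>
    (hv i hi).integrable_mul h2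
  have i2 : ∀ i ∈ s, Integrable (fun x => g i j x * φ x) := fun i hi =>
    (hg i hi j).integrable_mul h1
  rw [integral_finsetSum _ i1, integral_finsetSum _ i2, ← Finset.sum_neg_distrib]
  exact Finset.sum_congr rfl fun i hi => h i hi φ hφ hc j

/-! ### Fixed-time estimates of the flux and linear terms -/

lemma memLp_coord {μ : Measure R3} {U : R3 → R3} (hU : MemLp U 2 μ) (i : Fin 3) :
    MemLp (fun x => U x i) 2 μ :=
  (EuclideanSpace.proj (𝕜 := ℝ) i).comp_memLp' hU

lemma tsupport_subset_of_bump {x₀ : R3} (ζ : ContDiffBump x₀) {r : ℝ} (h : ζ.rOut < r) :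
    tsupport ζ ⊆ Metric.ball x₀ r := by
  rw [ζ.tsupport_eq]
  exact Metric.closedBall_subset_ball h

/-- Interior higher integrability of `|u|² + 2p` at a fixed time. -/
lemma memLp_head_pressure {x₀ : R3} {r ρ : ℝ} (hρ : 0 < ρ) (hr : ρ < r) {U : R3 → R3}
    {G : R3 → Matrix (Fin 3) (Fin 3) ℝ} {P : R3 → ℝ}
    (hU : MemLp U 2 (volume.restrict (Metric.ball x₀ r)))
    (hG : ∀ i j, MemLp (fun x => G x i j) 2 (volume.restrict (Metric.ball x₀ r)))
    (hUG : IsWeakGradient (Metric.ball x₀ r) U G)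
    (hP : MemLp P (3 / 2) (volume.restrict (Metric.ball x₀ r))) :
    MemLp (fun x => ‖U x‖ ^ 2 + 2 * P x) (3 / 2) (volume.restrict (Metric.closedBall x₀ ρ)) := by
  have hsub : Metric.closedBall x₀ ρ ⊆ Metric.ball x₀ r := Metric.closedBall_subset_ball hr
  have hPρ : MemLp P (3 / 2) (volume.restrict (Metric.closedBall x₀ ρ)) :=
    hP.mono_measure (Measure.restrict_mono hsub le_rfl)
  -- Since `ζ = 1` on the smaller ball, `L³` bounds for the compactly supported `ζ U_i` are `L³`
  -- bounds for `U_i` there; squares of `L³` functions lie in `L^{3/2}`, as `P` does.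
  let ζ : ContDiffBump x₀ := ⟨ρ, (ρ + r) / 2, hρ, by linarith⟩
  have hζs : tsupport ζ ⊆ Metric.ball x₀ r :=
    tsupport_subset_of_bump ζ (by change (ρ + r) / 2 < r; linarith)
  have h3 : ∀ i, MemLp (fun x => U x i) 3 (volume.restrict (Metric.closedBall x₀ ρ)) := by
    intro i
    have hd : ∀ j, Continuous (pd j ζ) ∧ HasCompactSupport (pd j ζ) ∧
        tsupport (pd j ζ) ⊆ Metric.ball x₀ r := fun j =>
      ⟨continuous_pd ζ.contDiff j, ζ.hasCompactSupport.mono'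
        ((subset_tsupport _).trans (tsupport_pd_subset ζ j)),
        (tsupport_pd_subset ζ j).trans hζs⟩
    have h4 : MemLp (fun x => ζ x * U x i) 3 :=
      memLp_three_of_hasWeakGrad (x₀ := x₀) (ρ := r)
        (memLp_mul_of_tsupport_subset measurableSet_ball ζ.continuous ζ.hasCompactSupport hζs
          (memLp_coord hU i))
        (fun j => (memLp_mul_of_tsupport_subset measurableSet_ball ζ.continuous
          ζ.hasCompactSupport hζs (hG i j)).add
          (memLp_mul_of_tsupport_subset measurableSet_ball (hd j).1 (hd j).2.1 (hd j).2.2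
            (memLp_coord hU i)))
        (hasWeakGrad_mul ζ.contDiff ζ.hasCompactSupport hζs (memLp_coord hU i) (hG i)
          fun φ h1 h2 h3 j => hUG φ h1 h2 h3 i j)
        (fun x hx => by
          rw [image_eq_zero_of_notMem_tsupport fun h => hx
            (Metric.ball_subset_closedBall (hζs h)), zero_mul])
    refine (memLp_congr_ae ?_).1 (h4.restrict (Metric.closedBall x₀ ρ))
    refine (ae_restrict_iff' measurableSet_closedBall).2 (Filter.Eventually.of_forall fun x hx => ?_)
    simp [ζ.one_of_mem_closedBall hx]
  have : ENNReal.HolderTriple 3 3 (3 / 2) := ⟨by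
    rw [ENNReal.inv_div (by simp) (by simp), ← one_div, ENNReal.div_add_div_same]
    norm_num⟩
  have h4 : ∀ i, MemLp (fun x => U x i ^ 2) (3 / 2) (volume.restrict (Metric.closedBall x₀ ρ)) :=
    fun i => by
      have h5 := (h3 i).mul (h3 i) (r := 3 / 2)
      simp only [sq]
      exact h5
  have h6 := (memLp_finsetSum Finset.univ fun i _ => h4 i).add (hPρ.const_mul 2)
  refine (memLp_congr_ae (Filter.Eventually.of_forall fun x => ?_)).1 h6
  simp [EuclideanSpace.norm_sq_eq]

/-- A real inequality between squares, integrated over a set outside which the function vanishes. -/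
lemma lintegral_enorm_sq_le_of_sq_le {s : Set R3} (hs : MeasurableSet s) {w h : R3 → ℝ}
    (hw : ∀ x ∉ s, w x = 0) (hle : ∀ x, w x ^ 2 ≤ h x) :
    ∫⁻ x, ‖w x‖ₑ ^ 2 ≤ ∫⁻ x in s, ENNReal.ofReal (h x) := by
  rw [← lintegral_indicator hs]
  refine lintegral_mono fun x => ?_
  by_cases hx : x ∈ s
  · rw [indicator_of_mem hx, ← ofReal_norm, ← ENNReal.ofReal_pow (norm_nonneg _)]
    refine ENNReal.ofReal_le_ofReal ?_
    rw [Real.norm_eq_abs, sq_abs]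
    exact hle x
  · simp [hw x hx]

/-- Cauchy–Schwarz over three components. Here `α` is a row of derivatives of the cutoff and `t` the
value of the cutoff, so the cutoff reappears as a weight on `β`. -/
lemma sum_mul_sq_le {c t : ℝ} {α β : Fin 3 → ℝ} (hα : ∀ j, α j ^ 2 ≤ c * t) :
    (∑ j, α j * β j) ^ 2 ≤ 3 * c * (t * ∑ j, β j ^ 2) := by
  refine (Finset.sum_mul_sq_le_sq_mul_sq _ _ _).trans ?_
  have : ∑ j, α j ^ 2 ≤ 3 * c * t := by
    refine (Finset.sum_le_sum fun j _ => hα j).trans (le_of_eq ?_)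
    simp
    ring
  calc _ ≤ 3 * c * t * ∑ j, β j ^ 2 := by
        refine mul_le_mul_of_nonneg_right this ?_
        positivity
    _ = _ := by ring

/-- The flux term of the local energy inequality at a fixed time. -/
lemma enorm_flux_le {σ : ℝ} (hσ : σ ∈ Icc (0 : ℝ) 1) {x₀ : R3} {r ρ : ℝ} (hρ : 0 < ρ)
    (hr : ρ < r) {U : R3 → R3}
    {G : R3 → Matrix (Fin 3) (Fin 3) ℝ} {P : R3 → ℝ}
    (hU : MemLp U 2 (volume.restrict (Metric.ball x₀ r)))
    (hG : ∀ i j, MemLp (fun x => G x i j) 2 (volume.restrict (Metric.ball x₀ r)))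
    (hUG : IsWeakGradient (Metric.ball x₀ r) U G)
    (hP : MemLp P (3 / 2) (volume.restrict (Metric.ball x₀ r)))
    {φ : R3 → ℝ} (hφ : ContDiff ℝ ∞ φ) (hs : tsupport φ ⊆ Metric.closedBall x₀ ρ)
    (hφ0 : ∀ x, 0 ≤ φ x) {c₁ c₂ : ℝ} (hc₁ : 0 ≤ c₁) (hc₂ : 0 ≤ c₂)
    (h₁ : ∀ j x, pd j φ x ^ 2 ≤ c₁ * φ x) (h₂ : ∀ j k x, pd k (pd j φ) x ^ 2 ≤ c₂ * φ x)
    {a b : ℝ≥0∞} (ha : a ≠ 0) (ha' : a ≠ ⊤) (hb : b ≠ 0) (hb' : b ≠ ⊤)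
    (hea : ENNReal.ofReal (3 * c₁) *
      ∫⁻ x in Metric.ball x₀ r, ENNReal.ofReal (φ x * ‖U x‖ ^ 2) ≤ a)
    (hdb : ENNReal.ofReal (6 * c₁) *
        (∫⁻ x in Metric.ball x₀ r, ENNReal.ofReal (φ x * sqNorm (G x))) +
      ENNReal.ofReal (18 * c₂) *
        (∫⁻ x in Metric.ball x₀ r, ENNReal.ofReal (φ x * ‖U x‖ ^ 2)) ≤ b) :
    ‖∫ x in Metric.ball x₀ r, (‖U x‖ ^ 2 + 2 * P x) * ∑ j, U x j * pd j φ x‖ₑ ≤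
      dualNorm σ x₀ r (fun x => ‖U x‖ ^ 2 + 2 * P x) * (a ^ ((1 - σ) / 2) * b ^ (σ / 2)) := by
  have hsb : tsupport φ ⊆ Metric.ball x₀ r := hs.trans (Metric.closedBall_subset_ball hr)
  have hc : HasCompactSupport φ := (isCompact_closedBall x₀ ρ).of_isClosed_subset
    (isClosed_tsupport φ) hs
  have hpd : ∀ j, tsupport (pd j φ) ⊆ Metric.ball x₀ r := fun j =>
    (tsupport_pd_subset φ j).trans hsb
  have hpdc : ∀ j, HasCompactSupport (pd j φ) := fun j =>
    hc.mono' ((subset_tsupport _).trans (tsupport_pd_subset φ j))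
  have hpd2 : ∀ j k, tsupport (pd k (pd j φ)) ⊆ Metric.ball x₀ r := fun j k =>
    (tsupport_pd_subset _ k).trans (hpd j)
  have hpdc2 : ∀ j k, HasCompactSupport (pd k (pd j φ)) := fun j k =>
    (hpdc j).mono' ((subset_tsupport _).trans (tsupport_pd_subset _ k))
  set v : R3 → ℝ := fun x => ∑ j, pd j φ x * U x j with hv
  set g : Fin 3 → R3 → ℝ := fun k x =>
    ∑ j, (pd j φ x * G x j k + pd k (pd j φ) x * U x j) with hg
  have m1 : ∀ j, MemLp (fun x => pd j φ x * U x j) 2 := fun j =>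
    memLp_mul_of_tsupport_subset measurableSet_ball (continuous_pd hφ j) (hpdc j) (hpd j)
      (memLp_coord hU j)
  have m2 : ∀ j k, MemLp (fun x => pd j φ x * G x j k + pd k (pd j φ) x * U x j) 2 := fun j k =>
    (memLp_mul_of_tsupport_subset measurableSet_ball (continuous_pd hφ j) (hpdc j) (hpd j)
      (hG j k)).add (memLp_mul_of_tsupport_subset measurableSet_ball
        (continuous_pd (contDiff_pd hφ j) k) (hpdc2 j k) (hpd2 j k) (memLp_coord hU j))
  have mv : MemLp v 2 := memLp_finsetSum Finset.univ fun j _ => m1 j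
  have mg : ∀ k, MemLp (g k) 2 := fun k => memLp_finsetSum Finset.univ fun j _ => m2 j k
  have hvg : HasWeakGrad v g := HasWeakGrad.sum Finset.univ (fun j _ => m1 j)
    (fun j _ k => m2 j k) fun j _ => hasWeakGrad_mul (contDiff_pd hφ j) (hpdc j) (hpd j)
      (memLp_coord hU j) (hG j) fun ψ q1 q2 q3 k => hUG ψ q1 q2 q3 j k
  have z0 : ∀ x ∉ Metric.closedBall x₀ ρ, ∀ j, pd j φ x = 0 := fun x hx j =>
    image_eq_zero_of_notMem_tsupport fun h => hx (hs (tsupport_pd_subset φ j h))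
  have z1 : ∀ x ∉ Metric.ball x₀ r, ∀ j, pd j φ x = 0 := fun x hx j =>
    image_eq_zero_of_notMem_tsupport fun h => hx (hpd j h)
  have z2 : ∀ x ∉ Metric.ball x₀ r, ∀ j k, pd k (pd j φ) x = 0 := fun x hx j k =>
    image_eq_zero_of_notMem_tsupport fun h => hx (hpd2 j k h)
  have hUm : AEMeasurable (fun x => ENNReal.ofReal (φ x * ‖U x‖ ^ 2))
      (volume.restrict (Metric.ball x₀ r)) := by
    have := hU.1.norm.aemeasurable
    have := hφ.continuous.measurable
    fun_prop
  have hGm : AEMeasurable (fun x => ENNReal.ofReal (φ x * sqNorm (G x)))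
      (volume.restrict (Metric.ball x₀ r)) := by
    have : ∀ i j, AEMeasurable (fun x => G x i j) (volume.restrict (Metric.ball x₀ r)) :=
      fun i j => (hG i j).1.aemeasurable
    have := hφ.continuous.measurable
    simp only [sqNorm]
    fun_prop
  have hres := enorm_integral_le_dualNorm_mul hσ (x₀ := x₀) (r := r) (ρ := ρ) (ρ' := (ρ + r) / 2)
    (by linarith) (by linarith)
    (memLp_head_pressure (by linarith) (by linarith) hU hG hUG hP) mv mg hvg
    (fun x hx => by simp [hv, z0 x hx]) ha ha' hb hb' ?_ ?_
  · refine le_trans (le_of_eq ?_) hres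
    simp only [hv, mul_comm]
  · refine le_trans ?_ hea
    rw [← lintegral_const_mul'' _ hUm]
    simp only [← ENNReal.ofReal_mul (by positivity : 0 ≤ 3 * c₁)]
    refine lintegral_enorm_sq_le_of_sq_le measurableSet_ball (fun x hx => by simp [hv, z1 x hx])
      fun x => ?_
    rw [EuclideanSpace.norm_sq_eq]
    simp only [Real.norm_eq_abs, sq_abs]
    exact sum_mul_sq_le fun j => h₁ j x
  · refine le_trans ?_ hdb
    -- The 6 is 2, from `(α + β)² ≤ 2α² + 2β²`, times 3 from `sum_mul_sq_le`. Summing over `k`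
    -- completes `|G|²` and turns the other 6 into 18.
    have hk : ∀ k, ∫⁻ x, ‖g k x‖ₑ ^ 2 ≤ ∫⁻ x in Metric.ball x₀ r,
        ENNReal.ofReal (6 * c₁ * (φ x * ∑ j, G x j k ^ 2) + 6 * c₂ * (φ x * ‖U x‖ ^ 2)) := by
      intro k
      refine lintegral_enorm_sq_le_of_sq_le measurableSet_ball
        (fun x hx => by simp [hg, z1 x hx, z2 x hx]) fun x => ?_
      rw [EuclideanSpace.norm_sq_eq]
      simp only [Real.norm_eq_abs, sq_abs]
      have q1 := sum_mul_sq_le (β := fun j => G x j k) fun j => h₁ j x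
      have q2 := sum_mul_sq_le (β := fun j => U x j) fun j => h₂ j k x
      simp only [hg, Finset.sum_add_distrib]
      nlinarith [sq_nonneg ((∑ j, pd j φ x * G x j k) - ∑ j, pd k (pd j φ) x * U x j)]
    refine (Finset.sum_le_sum fun k _ => hk k).trans ?_
    rw [← lintegral_finsetSum']
    · rw [← lintegral_const_mul'' _ hUm, ← lintegral_const_mul'' _ hGm,
        ← lintegral_add_left' (hGm.const_mul _)]
      refine lintegral_mono fun x => le_of_eq ?_
      have p1 : ∀ k, 0 ≤ φ x * ∑ j, G x j k ^ 2 := fun k =>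
        mul_nonneg (hφ0 x) (by positivity)
      have p2 : 0 ≤ φ x * ‖U x‖ ^ 2 := mul_nonneg (hφ0 x) (by positivity)
      rw [← ENNReal.ofReal_sum_of_nonneg fun k _ => by have := p1 k; positivity,
        ← ENNReal.ofReal_mul (by positivity), ← ENNReal.ofReal_mul (by positivity),
        ← ENNReal.ofReal_add]
      · congr 1
        simp only [sqNorm, Fin.sum_univ_three]
        ring
      · refine mul_nonneg (by positivity) (mul_nonneg (hφ0 x) ?_)
        exact Finset.sum_nonneg fun i _ => Finset.sum_nonneg fun j _ => sq_nonneg _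
      · positivity
    · intro k _
      have := hU.1.norm.aemeasurable
      have : ∀ i j, AEMeasurable (fun x => G x i j) (volume.restrict (Metric.ball x₀ r)) :=
        fun i j => (hG i j).1.aemeasurable
      have := hφ.continuous.measurable
      fun_prop

/-- The linear term of the local energy inequality at a fixed time. -/
lemma enorm_integral_test_le {σ : ℝ} (hσ : σ ∈ Icc (0 : ℝ) 1) {x₀ : R3} {r : ℝ} {f ψ : R3 → ℝ}
    (hψ : ContDiff ℝ ∞ ψ) (hs : tsupport ψ ⊆ Metric.ball x₀ r) {a b : ℝ≥0∞}
    (ha : a ≠ 0) (ha' : a ≠ ⊤) (hb : b ≠ 0) (hb' : b ≠ ⊤) (hψa : ∫⁻ y, ‖ψ y‖ₑ ^ 2 ≤ a)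
    (hψb : gradEnergy ψ ≤ b) :
    ‖∫ y in Metric.ball x₀ r, f y * ψ y‖ₑ ≤
      dualNorm σ x₀ r f * (a ^ ((1 - σ) / 2) * b ^ (σ / 2)) := by
  have h1 : 0 ≤ (1 - σ) / 2 := by linarith [hσ.2]
  have h2 : 0 ≤ σ / 2 := by linarith [hσ.1]
  have hne : a ^ ((1 - σ) / 2) * b ^ (σ / 2) ≠ 0 :=
    mul_ne_zero (ENNReal.rpow_pos (pos_iff_ne_zero.2 ha) ha').ne'
      (ENNReal.rpow_pos (pos_iff_ne_zero.2 hb) hb').ne'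
  have hne' : a ^ ((1 - σ) / 2) * b ^ (σ / 2) ≠ ⊤ :=
    ENNReal.mul_ne_top (ENNReal.rpow_ne_top_of_nonneg h1 ha')
      (ENNReal.rpow_ne_top_of_nonneg h2 hb')
  rw [dualNorm, ← ENNReal.div_le_iff hne hne']
  refine le_iInf₂ fun M hM => ?_
  obtain ⟨T, hT, hf⟩ := hM
  rw [ENNReal.div_le_iff hne hne']
  refine (enorm_integral_le_of_represents hσ hT hf hψ hs).trans ?_
  exact mul_le_mul_right (mul_le_mul' (ENNReal.rpow_le_rpow hψa h1) (ENNReal.rpow_le_rpow hψb h2)) _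

/-! ### Construction and scaling of the cutoff -/

lemma pd_const_mul {φ : R3 → ℝ} (hφ : ContDiff ℝ ∞ φ) (c : ℝ) (j : Fin 3) (x : R3) :
    pd j (fun y => c * φ y) x = c * pd j φ x := by
  rw [pd, fderiv_const_mul (hφ.differentiable (by simp)).differentiableAt]
  rfl

lemma pd_add {φ ψ : R3 → ℝ} (hφ : ContDiff ℝ ∞ φ) (hψ : ContDiff ℝ ∞ ψ) (j : Fin 3) (x : R3) :
    pd j (fun y => φ y + ψ y) x = pd j φ x + pd j ψ x := by
  rw [pd, fderiv_fun_add (hφ.differentiable (by simp)).differentiableAt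
    (hψ.differentiable (by simp)).differentiableAt]
  rfl

lemma pd_pow {φ : R3 → ℝ} (hφ : ContDiff ℝ ∞ φ) (n : ℕ) (j : Fin 3) (x : R3) :
    pd j (fun y => φ y ^ n) x = n * φ x ^ (n - 1) * pd j φ x := by
  rw [pd, fderiv_fun_pow n (hφ.differentiable (by simp)).differentiableAt]
  simp [pd]

lemma pd_comp_scale {F : R3 → ℝ} (hF : ContDiff ℝ ∞ F) (c : ℝ) (x₀ : R3) (j : Fin 3) (x : R3) :
    pd j (fun y => F (c • (y - x₀))) x = c * pd j F (c • (x - x₀)) := by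
  have h1 : HasFDerivAt (fun y : R3 => c • (y - x₀)) (c • ContinuousLinearMap.id ℝ R3) x :=
    ((hasFDerivAt_id x).sub_const x₀).const_smul c
  have h2 : HasFDerivAt (fun y => F (c • (y - x₀)))
      ((fderiv ℝ F (c • (x - x₀))).comp (c • ContinuousLinearMap.id ℝ R3)) x :=
    HasFDerivAt.comp x (hF.differentiable (by simp)).differentiableAt.hasFDerivAt h1
  rw [pd, h2.fderiv]
  simp [pd]

lemma contDiff_comp_scale {F : R3 → ℝ} (hF : ContDiff ℝ ∞ F) (c : ℝ) (x₀ : R3) :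
    ContDiff ℝ ∞ (fun y => F (c • (y - x₀))) :=
  hF.comp ((contDiff_id.sub contDiff_const).const_smul c)

/-- The spatial cutoff is a fourth power, so that the squares of its first and second derivatives
are bounded by the cutoff itself. -/
lemma exists_space_cutoff : ∃ (X : R3 → ℝ) (K : ℝ), ContDiff ℝ ∞ X ∧ 0 ≤ K ∧ (∀ y, 0 ≤ X y) ∧
    (∀ y, X y ≤ 1) ∧ (∀ y ∈ Metric.closedBall (0 : R3) (1 / 2), X y = 1) ∧
    tsupport X ⊆ Metric.closedBall 0 (3 / 4) ∧ (∀ j y, pd j X y ^ 2 ≤ K * X y) ∧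
    (∀ j k y, pd k (pd j X) y ^ 2 ≤ K * X y) := by
  let χ : ContDiffBump (0 : R3) := ⟨1 / 2, 3 / 4, by norm_num, by norm_num⟩
  have hχ : ContDiff ℝ ∞ χ := χ.contDiff
  have hχc := χ.hasCompactSupport
  have hpc : ∀ j, HasCompactSupport (pd j χ) := fun j =>
    hχc.mono' ((subset_tsupport _).trans (tsupport_pd_subset χ j))
  have hpc2 : ∀ j k, HasCompactSupport (pd k (pd j χ)) := fun j k =>
    (hpc j).mono' ((subset_tsupport _).trans (tsupport_pd_subset _ k))
  choose C₁ hC₁ using fun j => (continuous_pd hχ j).bounded_above_of_compact_support (hpc j)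
  choose C₂ hC₂ using fun j k =>
    (continuous_pd (contDiff_pd hχ j) k).bounded_above_of_compact_support (hpc2 j k)
  obtain ⟨K, hK0, hK1, hK2⟩ : ∃ K : ℝ, 0 ≤ K ∧ (∀ j y, pd j χ y ^ 2 ≤ K) ∧
      ∀ j k y, pd k (pd j χ) y ^ 2 ≤ K := by
    refine ⟨(∑ j, C₁ j ^ 2) + ∑ j, ∑ k, C₂ j k ^ 2, by positivity, fun j y => ?_, fun j k y => ?_⟩
    · have h1 := pow_le_pow_left₀ (norm_nonneg _) (hC₁ j y) 2
      rw [Real.norm_eq_abs, sq_abs] at h1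
      have h2 := Finset.single_le_sum (f := fun j => C₁ j ^ 2) (fun i _ => sq_nonneg _)
        (Finset.mem_univ j)
      have h3 : 0 ≤ ∑ j, ∑ k, C₂ j k ^ 2 := by positivity
      linarith
    · have h1 := pow_le_pow_left₀ (norm_nonneg _) (hC₂ j k y) 2
      rw [Real.norm_eq_abs, sq_abs] at h1
      have h2 := Finset.single_le_sum (f := fun k => C₂ j k ^ 2) (fun i _ => sq_nonneg _)
        (Finset.mem_univ k)
      have h4 := Finset.single_le_sum (f := fun j => ∑ k, C₂ j k ^ 2)
        (fun i _ => by positivity) (Finset.mem_univ j)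
      have h3 : 0 ≤ ∑ j, C₁ j ^ 2 := by positivity
      linarith
  have d1 : ∀ j, pd j (fun y => χ y ^ 4) = fun y => χ y ^ 3 * (4 * pd j χ y) := by
    intro j
    funext y
    rw [pd_pow hχ]
    norm_num
    ring
  have d2 : ∀ j k y, pd k (pd j (fun y => χ y ^ 4)) y =
      χ y ^ 3 * (4 * pd k (pd j χ) y) + 3 * χ y ^ 2 * pd k χ y * (4 * pd j χ y) := by
    intro j k y
    rw [d1, pd_mul (hχ.pow 3) (contDiff_const.mul (contDiff_pd hχ j)),
      pd_const_mul (contDiff_pd hχ j), pd_pow hχ]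
    norm_num
  have hp : ∀ y, χ y ^ 6 ≤ χ y ^ 4 := fun y =>
    pow_le_pow_of_le_one χ.nonneg χ.le_one (by norm_num)
  -- First derivatives of `χ⁴` cost `16K`. In the second ones the two product-rule terms have
  -- squares at most `16Kχ⁴` and `144K²χ⁴`, doubled by `(α + β)² ≤ 2α² + 2β²`.
  refine ⟨fun y => χ y ^ 4, 16 * K + 32 * K + 288 * K ^ 2, hχ.pow 4, by positivity,
    fun y => by have := χ.nonneg' y; positivity, fun y => pow_le_one₀ (χ.nonneg' y) χ.le_one,
    fun y hy => by simp only [χ.one_of_mem_closedBall hy, one_pow], ?_, fun j y => ?_,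
    fun j k y => ?_⟩
  · refine Subset.trans (closure_mono fun y (hy : χ y ^ 4 ≠ 0) => ?_) (le_of_eq χ.tsupport_eq)
    exact fun h => hy (by simp [h])
  · rw [d1]
    have h4 : 0 ≤ χ y ^ 4 := by have := χ.nonneg' y; positivity
    have h6 : 0 ≤ χ y ^ 6 := by have := χ.nonneg' y; positivity
    calc (χ y ^ 3 * (4 * pd j χ y)) ^ 2 = 16 * (χ y ^ 6 * pd j χ y ^ 2) := by ring
      _ ≤ 16 * (χ y ^ 4 * K) := by
        have := mul_le_mul (hp y) (hK1 j y) (sq_nonneg _) h4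
        linarith
      _ ≤ _ := by nlinarith [mul_nonneg hK0 h4, mul_nonneg (sq_nonneg K) h4]
  · rw [d2]
    have h4 : 0 ≤ χ y ^ 4 := by have := χ.nonneg' y; positivity
    have e1 : (χ y ^ 3 * (4 * pd k (pd j χ) y)) ^ 2 ≤ 16 * (χ y ^ 4 * K) := by
      have := mul_le_mul (hp y) (hK2 j k y) (sq_nonneg _) h4
      nlinarith
    have e2 : (3 * χ y ^ 2 * pd k χ y * (4 * pd j χ y)) ^ 2 ≤ 144 * (χ y ^ 4 * K ^ 2) := by
      have := mul_le_mul (hK1 k y) (hK1 j y) (sq_nonneg _) hK0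
      have := mul_le_mul_of_nonneg_left this h4
      nlinarith
    have e3 := sq_nonneg (χ y ^ 3 * (4 * pd k (pd j χ) y) -
      3 * χ y ^ 2 * pd k χ y * (4 * pd j χ y))
    nlinarith [mul_nonneg hK0 h4]

lemma volume_closedBall_le (x₀ : R3) {r : ℝ} (hr : 0 < r) : ∃ V : ℝ, V = r ^ 3 *
    (volume (Metric.ball (0 : R3) 1)).toReal ∧
    volume (Metric.closedBall x₀ r) = ENNReal.ofReal V := by
  refine ⟨_, rfl, ?_⟩
  rw [Measure.addHaar_closedBall _ _ hr.le, ENNReal.ofReal_mul (by positivity),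
    ENNReal.ofReal_toReal measure_ball_lt_top.ne]
  simp [finrank_euclideanSpace]

lemma lintegral_enorm_sq_le_of_bounded {w : R3 → ℝ} {x₀ : R3} {r c : ℝ} (hr : 0 < r)
    (hw : ∀ x ∉ Metric.closedBall x₀ r, w x = 0) (hc : ∀ x, w x ^ 2 ≤ c) :
    ∫⁻ x, ‖w x‖ₑ ^ 2 ≤
      ENNReal.ofReal (c * r ^ 3 * (volume (Metric.ball (0 : R3) 1)).toReal) := by
  refine (lintegral_enorm_sq_le_of_sq_le measurableSet_closedBall hw hc).trans ?_
  have hc0 : 0 ≤ c := (sq_nonneg _).trans (hc 0)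
  obtain ⟨V, hV, hV'⟩ := volume_closedBall_le x₀ hr
  rw [setLIntegral_const, hV', ← ENNReal.ofReal_mul hc0, hV, mul_assoc]

lemma dx_eq_pd {φ : R3 × ℝ → ℝ} (hφ : ContDiff ℝ ∞ φ) (j : Fin 3) (x : R3) (t : ℝ) :
    dx j φ (x, t) = pd j (fun y => φ (y, t)) x := by
  have h : HasFDerivAt (fun y => φ (y, t))
      ((fderiv ℝ φ (x, t)).comp (ContinuousLinearMap.inl ℝ R3 ℝ)) x :=
    HasFDerivAt.comp x (hφ.differentiable (by simp)).differentiableAt.hasFDerivAt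
      (hasFDerivAt_prodMk_left x t)
  rw [pd, h.fderiv]
  simp [dx]

lemma dt_eq_deriv {φ : R3 × ℝ → ℝ} (hφ : ContDiff ℝ ∞ φ) (x : R3) (t : ℝ) :
    dt φ (x, t) = deriv (fun s => φ (x, s)) t := by
  have h : HasFDerivAt (fun s => φ (x, s))
      ((fderiv ℝ φ (x, t)).comp (ContinuousLinearMap.inr ℝ R3 ℝ)) t :=
    HasFDerivAt.comp t (hφ.differentiable (by simp)).differentiableAt.hasFDerivAt
      (hasFDerivAt_prodMk_right x t)
  rw [← fderiv_apply_one_eq_deriv, h.fderiv]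
  simp [dt]

lemma contDiff_dx {φ : R3 × ℝ → ℝ} (hφ : ContDiff ℝ ∞ φ) (j : Fin 3) : ContDiff ℝ ∞ (dx j φ) :=
  (hφ.fderiv_right (m := ∞) (by simp)).clm_apply contDiff_const

lemma contDiff_dt {φ : R3 × ℝ → ℝ} (hφ : ContDiff ℝ ∞ φ) : ContDiff ℝ ∞ (dt φ) :=
  (hφ.fderiv_right (m := ∞) (by simp)).clm_apply contDiff_const

lemma dx_dx_eq_pd {φ : R3 × ℝ → ℝ} (hφ : ContDiff ℝ ∞ φ) (j k : Fin 3) (x : R3) (t : ℝ) :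
    dx k (dx j φ) (x, t) = pd k (pd j fun y => φ (y, t)) x := by
  rw [dx_eq_pd (contDiff_dx hφ j)]
  congr 1
  funext y
  exact dx_eq_pd hφ j y t

lemma exists_sq_le_of_hasCompactSupport {E : Type*} [TopologicalSpace E] {f : E → ℝ}
    (hf : Continuous f) (hc : HasCompactSupport f) : ∃ B : ℝ, 0 ≤ B ∧ ∀ x, f x ^ 2 ≤ B := by
  obtain ⟨C, hC⟩ := hf.bounded_above_of_compact_support hc
  refine ⟨C ^ 2, sq_nonneg _, fun x => ?_⟩
  have := pow_le_pow_left₀ (norm_nonneg _) (hC x) 2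
  rwa [Real.norm_eq_abs, sq_abs] at this

/-- The parabolic cutoff at scale `r` near `(x₀, t₀)`. -/
lemma exists_cutoff : ∃ K : ℝ, 0 < K ∧ ∀ (x₀ : R3) (t₀ r : ℝ), 0 < r → ∃ φ : R3 × ℝ → ℝ,
    ContDiff ℝ ∞ φ ∧ HasCompactSupport φ ∧ (∀ z, 0 ≤ φ z) ∧ (∀ z, φ z ≤ 1) ∧
    (∀ z ∉ Metric.closedBall x₀ (3 / 4 * r) ×ˢ Icc (t₀ - r ^ 2 / 2) (t₀ + r ^ 2 / 2), φ z = 0) ∧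
    (∀ z ∈ Metric.closedBall x₀ (r / 2) ×ˢ Icc (t₀ - r ^ 2 / 4) t₀, φ z = 1) ∧
    (∀ t, tsupport (fun x => φ (x, t)) ⊆ Metric.closedBall x₀ (3 / 4 * r)) ∧
    (∀ t j x, pd j (fun y => φ (y, t)) x ^ 2 ≤ K / r ^ 2 * φ (x, t)) ∧
    (∀ t j k x, pd k (pd j (fun y => φ (y, t))) x ^ 2 ≤ K / r ^ 4 * φ (x, t)) ∧
    (∀ t, tsupport (fun x => dt φ (x, t) + ∑ j, dx j (dx j φ) (x, t)) ⊆
      Metric.closedBall x₀ (3 / 4 * r)) ∧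
    (∀ t, ∫⁻ x, ‖dt φ (x, t) + ∑ j, dx j (dx j φ) (x, t)‖ₑ ^ 2 ≤ ENNReal.ofReal (K / r)) ∧
    ∀ t, gradEnergy (fun x => dt φ (x, t) + ∑ j, dx j (dx j φ) (x, t)) ≤
      ENNReal.ofReal (K / r ^ 3) := by
  obtain ⟨X, K, hX, hK, hX0, hX1, hXone, hXs, hXd, hXdd⟩ := exists_space_cutoff
  have hXc : HasCompactSupport X := (isCompact_closedBall (0 : R3) (3 / 4)).of_isClosed_subset
    (isClosed_tsupport X) hXs
  -- The radius `1/4` matches `(r/2)² = r²/4`, and `1/2 < 1` makes the cutoff vanish near the bottom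
  -- of the cylinder. It need not vanish at the top, which is not in the parabolic boundary.
  let Θ : ContDiffBump (0 : ℝ) := ⟨1 / 4, 1 / 2, by norm_num, by norm_num⟩
  have hΘ : ContDiff ℝ ∞ Θ := Θ.contDiff
  set L : R3 → ℝ := fun y => ∑ j, pd j (pd j X) y with hL
  have hLd : ContDiff ℝ ∞ L := ContDiff.sum fun j _ => contDiff_pd (contDiff_pd hX j) j
  have hX' : ∀ y ∉ Metric.closedBall (0 : R3) (3 / 4), X y = 0 := fun y hy =>
    image_eq_zero_of_notMem_tsupport fun h => hy (hXs h)
  have hL' : ∀ y ∉ Metric.closedBall (0 : R3) (3 / 4), L y = 0 := fun y hy =>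
    Finset.sum_eq_zero fun j _ => image_eq_zero_of_notMem_tsupport fun h => hy
      (hXs (tsupport_pd_subset X j (tsupport_pd_subset _ j h)))
  have hLc : HasCompactSupport L :=
    HasCompactSupport.intro (isCompact_closedBall (0 : R3) (3 / 4)) hL'
  have hLk : ∀ k, HasCompactSupport (pd k L) := fun k =>
    hLc.mono' ((subset_tsupport _).trans (tsupport_pd_subset L k))
  obtain ⟨D, hD0, hD⟩ := exists_sq_le_of_hasCompactSupport (hΘ.continuous_deriv (by simp))
    Θ.hasCompactSupport.deriv
  obtain ⟨B, hB0, hB⟩ := exists_sq_le_of_hasCompactSupport hLd.continuous hLc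
  choose B' hB'0 hB' using fun k =>
    exists_sq_le_of_hasCompactSupport (continuous_pd hLd k) (hLk k)
  set V := (volume (Metric.ball (0 : R3) 1)).toReal with hV
  have hV0 : 0 ≤ V := ENNReal.toReal_nonneg
  set N₀ := 2 * (D + B) with hN₀
  set N₁ := ∑ k, 2 * (D * K + B' k) with hN₁
  have hN₀0 : 0 ≤ N₀ := by positivity
  have hN₁0 : 0 ≤ N₁ := Finset.sum_nonneg fun k _ => by have := hB'0 k; positivity
  have hcomb : ∀ s : ℝ, ∀ α β A' C' : ℝ, α ^ 2 ≤ A' → β ^ 2 ≤ C' →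
      (deriv Θ s * α + Θ s * β) ^ 2 ≤ 2 * (D * A' + C') := by
    intro s α β A' C' h1 h2
    have e1 : (deriv Θ s * α) ^ 2 ≤ D * A' := by
      rw [mul_pow]
      exact mul_le_mul (hD s) h1 (sq_nonneg _) hD0
    have e2 : (Θ s * β) ^ 2 ≤ C' := by
      rw [mul_pow]
      have : Θ s ^ 2 ≤ 1 := pow_le_one₀ Θ.nonneg Θ.le_one
      nlinarith [sq_nonneg β]
    nlinarith [sq_nonneg (deriv Θ s * α - Θ s * β)]
  -- One constant serves all bounds: `K` for derivatives of the cutoff, `N₀V` and `N₁V` for the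
  -- squared norms of `∂ₜφ + Δφ` and its gradient at unit scale, and 1 for positivity.
  refine ⟨K + N₀ * V + N₁ * V + 1, by positivity, fun x₀ t₀ r hr => ?_⟩
  have hr2 : 0 < r ^ 2 := by positivity
  set φ : R3 × ℝ → ℝ := fun z => Θ ((r ^ 2)⁻¹ * (z.2 - t₀)) * X (r⁻¹ • (z.1 - x₀)) with hφ
  have hφd : ContDiff ℝ ∞ φ := by
    refine (hΘ.comp ?_).mul (hX.comp ?_)
    · exact contDiff_const.mul (contDiff_snd.sub contDiff_const)
    · exact (contDiff_fst.sub contDiff_const).const_smul _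
  have hmem : ∀ (x : R3) (c : ℝ), r⁻¹ • (x - x₀) ∈ Metric.closedBall (0 : R3) c ↔
      x ∈ Metric.closedBall x₀ (c * r) := by
    intro x c
    rw [mem_closedBall_zero_iff, norm_smul, Metric.mem_closedBall, dist_eq_norm, Real.norm_eq_abs,
      abs_of_pos (inv_pos.2 hr), inv_mul_le_iff₀ hr, mul_comm]
  have htime : ∀ (t c : ℝ), (r ^ 2)⁻¹ * (t - t₀) ∈ Metric.closedBall (0 : ℝ) c ↔
      |t - t₀| ≤ c * r ^ 2 := by
    intro t c
    rw [mem_closedBall_zero_iff, norm_mul, Real.norm_eq_abs, Real.norm_eq_abs,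
      abs_of_pos (inv_pos.2 hr2), inv_mul_le_iff₀ hr2, mul_comm]
  have hout : ∀ z ∉ Metric.closedBall x₀ (3 / 4 * r) ×ˢ Icc (t₀ - r ^ 2 / 2) (t₀ + r ^ 2 / 2),
      φ z = 0 := by
    rintro ⟨x, t⟩ hz
    by_cases hx : x ∈ Metric.closedBall x₀ (3 / 4 * r)
    · have ht : (r ^ 2)⁻¹ * (t - t₀) ∉ Metric.closedBall (0 : ℝ) (1 / 2) := by
        rw [htime]
        intro h
        rw [abs_le] at h
        exact hz ⟨hx, by constructor <;> simp only <;> linarith⟩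
      have : Θ ((r ^ 2)⁻¹ * (t - t₀)) = 0 := Θ.zero_of_le_dist (le_of_not_ge ht)
      simp [hφ, this]
    · simp [hφ, hX' _ (fun h => hx ((hmem x _).1 h))]
  have hd1 : ∀ t j, pd j (fun y => φ (y, t)) = fun x =>
      Θ ((r ^ 2)⁻¹ * (t - t₀)) * (r⁻¹ * pd j X (r⁻¹ • (x - x₀))) := by
    intro t j
    funext x
    simp only [hφ]
    rw [pd_const_mul (contDiff_comp_scale hX _ _), pd_comp_scale hX]
  have hd2 : ∀ t j k x, pd k (pd j (fun y => φ (y, t))) x =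
      Θ ((r ^ 2)⁻¹ * (t - t₀)) * (r⁻¹ * (r⁻¹ * pd k (pd j X) (r⁻¹ • (x - x₀)))) := by
    intro t j k x
    have hj := contDiff_comp_scale (contDiff_pd hX j) r⁻¹ x₀
    rw [hd1, pd_const_mul (contDiff_const.mul hj), pd_const_mul hj,
      pd_comp_scale (contDiff_pd hX j)]
  have hd3 : ∀ t, (fun x => dt φ (x, t) + ∑ j, dx j (dx j φ) (x, t)) = fun x =>
      r⁻¹ ^ 2 * (deriv Θ ((r ^ 2)⁻¹ * (t - t₀)) * X (r⁻¹ • (x - x₀)) +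
        Θ ((r ^ 2)⁻¹ * (t - t₀)) * L (r⁻¹ • (x - x₀))) := by
    intro t
    funext x
    have e1 : dt φ (x, t) =
        deriv Θ ((r ^ 2)⁻¹ * (t - t₀)) * (r ^ 2)⁻¹ * X (r⁻¹ • (x - x₀)) := by
      rw [dt_eq_deriv hφd]
      have e2 : HasDerivAt (fun s => (r ^ 2)⁻¹ * (s - t₀)) ((r ^ 2)⁻¹) t := by
        simpa using ((hasDerivAt_id t).sub_const t₀).const_mul (r ^ 2)⁻¹
      have e3 : HasDerivAt Θ (deriv Θ ((r ^ 2)⁻¹ * (t - t₀))) ((r ^ 2)⁻¹ * (t - t₀)) :=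
        (hΘ.differentiable (by simp)).differentiableAt.hasDerivAt
      have e4 : HasDerivAt (fun s => φ (x, s))
          (deriv Θ ((r ^ 2)⁻¹ * (t - t₀)) * (r ^ 2)⁻¹ * X (r⁻¹ • (x - x₀))) t :=
        (HasDerivAt.comp t e3 e2).mul_const (X (r⁻¹ • (x - x₀)))
      exact e4.deriv
    simp only [dx_dx_eq_pd hφd, hd2, e1, hL, Finset.mul_sum, mul_add]
    congr 1
    · field_simp
    · exact Finset.sum_congr rfl fun j _ => by ring
  have hWd : ∀ s : ℝ, ContDiff ℝ ∞ fun y => deriv Θ s * X y + Θ s * L y := fun s =>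
    (contDiff_const.mul hX).add (contDiff_const.mul hLd)
  have hd4 : ∀ t k, pd k (fun x => dt φ (x, t) + ∑ j, dx j (dx j φ) (x, t)) = fun x =>
      r⁻¹ ^ 3 * (deriv Θ ((r ^ 2)⁻¹ * (t - t₀)) * pd k X (r⁻¹ • (x - x₀)) +
        Θ ((r ^ 2)⁻¹ * (t - t₀)) * pd k L (r⁻¹ • (x - x₀))) := by
    intro t k
    funext x
    rw [hd3, pd_const_mul (contDiff_comp_scale (hWd _) r⁻¹ x₀), pd_comp_scale (hWd _),
      pd_add (contDiff_const.mul hX) (contDiff_const.mul hLd), pd_const_mul hX, pd_const_mul hLd]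
    ring
  have hz3 : ∀ t, ∀ x ∉ Metric.closedBall x₀ (3 / 4 * r),
      dt φ (x, t) + ∑ j, dx j (dx j φ) (x, t) = 0 := by
    intro t x hx
    rw [congrFun (hd3 t) x, hX' _ (fun h => hx ((hmem x _).1 h)),
      hL' _ (fun h => hx ((hmem x _).1 h))]
    ring
  have hts : ∀ t, tsupport (fun x => dt φ (x, t) + ∑ j, dx j (dx j φ) (x, t)) ⊆
      Metric.closedBall x₀ (3 / 4 * r) := fun t =>
    closure_minimal (fun x hx => by_contra fun h => hx (hz3 t x h)) Metric.isClosed_closedBall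
  have hsub : Metric.closedBall x₀ (3 / 4 * r) ⊆ Metric.closedBall x₀ r :=
    Metric.closedBall_subset_closedBall (by linarith)
  refine ⟨φ, hφd, ?_, fun z => mul_nonneg Θ.nonneg (hX0 _), fun z =>
    mul_le_one₀ Θ.le_one (hX0 _) (hX1 _), hout, ?_, ?_, ?_, ?_, hts, ?_, ?_⟩
  · exact HasCompactSupport.intro ((isCompact_closedBall _ _).prod isCompact_Icc) hout
  · rintro ⟨x, t⟩ ⟨hx, ht⟩
    have h1 : Θ ((r ^ 2)⁻¹ * (t - t₀)) = 1 := by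
      refine Θ.one_of_mem_closedBall ((htime t (1 / 4)).2 ?_)
      simp only [mem_Icc] at ht
      rw [abs_le]
      constructor <;> linarith
    have h2 : X (r⁻¹ • (x - x₀)) = 1 :=
      hXone _ ((hmem x _).2 (by simpa only [one_div_mul_eq_div] using hx))
    simp only [hφ, h1, h2, mul_one]
  · intro t
    refine closure_minimal (fun x hx => by_contra fun h => hx (hout _ fun h' => h h'.1))
      Metric.isClosed_closedBall
  · intro t j x
    rw [congrFun (hd1 t j) x]
    simp only [hφ]
    generalize (r ^ 2)⁻¹ * (t - t₀) = s
    generalize r⁻¹ • (x - x₀) = y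
    -- Only spatial derivatives must be dominated by the cutoff, so `0 ≤ Θ ≤ 1` suffices and no
    -- power of `Θ` is needed.
    have h1 : Θ s ^ 2 ≤ Θ s := by nlinarith [Θ.nonneg' s, Θ.le_one (x := s)]
    have h2 := mul_le_mul h1 (hXd j y) (sq_nonneg _) (Θ.nonneg' s)
    have h3 : 0 ≤ Θ s * X y := mul_nonneg (Θ.nonneg' s) (hX0 y)
    calc (Θ s * (r⁻¹ * pd j X y)) ^ 2 = Θ s ^ 2 * pd j X y ^ 2 / r ^ 2 := by field_simp
      _ ≤ (Θ s * (K * X y)) / r ^ 2 := by gcongr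
      _ = K / r ^ 2 * (Θ s * X y) := by ring
      _ ≤ _ := by
        refine mul_le_mul_of_nonneg_right (div_le_div_of_nonneg_right ?_ hr2.le) h3
        nlinarith [mul_nonneg hN₀0 hV0, mul_nonneg hN₁0 hV0]
  · intro t j k x
    rw [hd2]
    simp only [hφ]
    generalize (r ^ 2)⁻¹ * (t - t₀) = s
    generalize r⁻¹ • (x - x₀) = y
    have h1 : Θ s ^ 2 ≤ Θ s := by nlinarith [Θ.nonneg' s, Θ.le_one (x := s)]
    have h2 := mul_le_mul h1 (hXdd j k y) (sq_nonneg _) (Θ.nonneg' s)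
    have h3 : 0 ≤ Θ s * X y := mul_nonneg (Θ.nonneg' s) (hX0 y)
    calc (Θ s * (r⁻¹ * (r⁻¹ * pd k (pd j X) y))) ^ 2 =
        Θ s ^ 2 * pd k (pd j X) y ^ 2 / r ^ 4 := by field_simp
      _ ≤ (Θ s * (K * X y)) / r ^ 4 := by gcongr
      _ = K / r ^ 4 * (Θ s * X y) := by ring
      _ ≤ _ := by
        refine mul_le_mul_of_nonneg_right (div_le_div_of_nonneg_right ?_ (by positivity)) h3
        nlinarith [mul_nonneg hN₀0 hV0, mul_nonneg hN₁0 hV0]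
  · intro t
    refine (lintegral_enorm_sq_le_of_bounded (c := r⁻¹ ^ 4 * N₀) hr
      (fun x hx => hz3 t x fun h => hx (hsub h)) fun x => ?_).trans ?_
    · rw [congrFun (hd3 t) x, mul_pow]
      have h1 : X (r⁻¹ • (x - x₀)) ^ 2 ≤ 1 := pow_le_one₀ (hX0 _) (hX1 _)
      have := hcomb ((r ^ 2)⁻¹ * (t - t₀)) _ _ _ _ h1 (hB (r⁻¹ • (x - x₀)))
      rw [mul_one] at this
      calc _ = r⁻¹ ^ 4 * _ := by rw [← pow_mul]
        _ ≤ _ := by gcongr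
    · refine ENNReal.ofReal_le_ofReal ?_
      calc r⁻¹ ^ 4 * N₀ * r ^ 3 * V = N₀ * V / r := by field_simp
        _ ≤ _ := by
          refine div_le_div_of_nonneg_right ?_ hr.le
          nlinarith [mul_nonneg hN₁0 hV0]
  · intro t
    have h1 : ∀ k, ∫⁻ x, ‖pd k (fun x => dt φ (x, t) + ∑ j, dx j (dx j φ) (x, t)) x‖ₑ ^ 2 ≤
        ENNReal.ofReal (r⁻¹ ^ 6 * (2 * (D * K + B' k)) * r ^ 3 * V) := by
      intro k
      refine lintegral_enorm_sq_le_of_bounded (x₀ := x₀) hr (fun x hx => ?_) fun x => ?_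
      · exact image_eq_zero_of_notMem_tsupport fun h =>
          hx (hsub (hts t (tsupport_pd_subset _ k h)))
      · rw [congrFun (hd4 t k) x, mul_pow]
        have h1 : pd k X (r⁻¹ • (x - x₀)) ^ 2 ≤ K := (hXd k _).trans
          (mul_le_of_le_one_right hK (hX1 _))
        have := hcomb ((r ^ 2)⁻¹ * (t - t₀)) _ _ _ _ h1 (hB' k (r⁻¹ • (x - x₀)))
        calc _ = r⁻¹ ^ 6 * _ := by rw [← pow_mul]
          _ ≤ _ := by gcongr
    refine (Finset.sum_le_sum fun k _ => h1 k).trans ?_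
    rw [← ENNReal.ofReal_sum_of_nonneg fun k _ => by have := hB'0 k; positivity]
    refine ENNReal.ofReal_le_ofReal ?_
    rw [← Finset.sum_mul, ← Finset.sum_mul, ← Finset.mul_sum, ← hN₁]
    calc r⁻¹ ^ 6 * N₁ * r ^ 3 * V = N₁ * V / r ^ 3 := by field_simp
      _ ≤ _ := by
        refine div_le_div_of_nonneg_right ?_ (by positivity)
        nlinarith [mul_nonneg hN₀0 hV0]

/-! ### Time slices, Hölder in time, absorption -/

/-- Fubini when `F` is integrable; otherwise the left-hand integral is zero by convention, so no
integrability has to be checked for the cubic and pressure terms. -/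
lemma enorm_setIntegral_prod_le (F : R3 × ℝ → ℝ) (S : Set R3) (J : Set ℝ) :
    ‖∫ z in S ×ˢ J, F z‖ₑ ≤ ∫⁻ t in J, ‖∫ x in S, F (x, t)‖ₑ := by
  rw [Measure.volume_eq_prod, ← Measure.prod_restrict]
  by_cases hF : Integrable F ((volume.restrict S).prod (volume.restrict J))
  · rw [integral_prod_symm _ hF]
    exact enorm_integral_le_lintegral_enorm _
  · rw [integral_undef hF]
    simp

lemma ae_memLp_slice {F : Type*} [NormedAddCommGroup F] {f : R3 × ℝ → F} {p : ℝ≥0∞} (hp : p ≠ 0)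
    (hp' : p ≠ ⊤) {S : Set R3} {J : Set ℝ}
    (hf : MemLp f p (volume.restrict (S ×ˢ J))) :
    ∀ᵐ t ∂volume.restrict J, MemLp (fun x => f (x, t)) p (volume.restrict S) := by
  rw [Measure.volume_eq_prod, ← Measure.prod_restrict] at hf
  have h1 := hf.1.prod_swap.prodMk_left
  have h2 := ((integrable_norm_rpow_iff hf.1 hp hp').2 hf).prod_left_ae
  filter_upwards [h1, h2] with t ht1 ht2
  exact (integrable_norm_rpow_iff ht1 hp hp').1 ht2

/-- Hölder's inequality in time, without measurability of the factor `N`. -/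
lemma lintegral_le_mul_of_le_mul_rpow {σ : ℝ} (hσ : σ ∈ Icc (0 : ℝ) 1) {ν : Measure ℝ}
    {N g b : ℝ → ℝ≥0∞} {A : ℝ≥0∞} (hA : A ≠ 0) (hA' : A ≠ ⊤) (hg : AEMeasurable g ν)
    (hb : AEMeasurable b ν) (hb0 : ∀ t, b t ≠ 0) (hb' : ∀ᵐ t ∂ν, b t ≠ ⊤)
    (h : ∀ᵐ t ∂ν, g t ≤ N t * (A * b t ^ (σ / 2))) :
    ∫⁻ t, g t ∂ν ≤
      A * ((∫⁻ t, N t ^ (2 / (2 - σ)) ∂ν) ^ ((2 - σ) / 2) * (∫⁻ t, b t ∂ν) ^ (σ / 2)) := by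
  have h2σ : 0 < 2 - σ := by linarith [hσ.2]
  have hσ2 : 0 ≤ σ / 2 := by linarith [hσ.1]
  -- A measurable minorant of `N` for which the assumed inequality becomes an equality; Hölder is
  -- applied to it in place of `N`.
  set N' : ℝ → ℝ≥0∞ := fun t => g t / (A * b t ^ (σ / 2)) with hN'
  have hN'm : AEMeasurable N' ν := hg.div ((hb.pow_const _).const_mul A)
  have hN'le : ∀ᵐ t ∂ν, N' t ≤ N t := by
    filter_upwards [h] with t ht
    exact ENNReal.div_le_of_le_mul ht
  have hgN : ∀ᵐ t ∂ν, g t = A * ((N' t ^ (2 / (2 - σ))) ^ ((2 - σ) / 2) * b t ^ (σ / 2)) := by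
    filter_upwards [hb'] with t ht
    have h0 : A * b t ^ (σ / 2) ≠ 0 :=
      mul_ne_zero hA (ENNReal.rpow_pos (pos_iff_ne_zero.2 (hb0 t)) ht).ne'
    have h1 : A * b t ^ (σ / 2) ≠ ⊤ := ENNReal.mul_ne_top hA' (ENNReal.rpow_ne_top_of_nonneg hσ2 ht)
    have e : 2 / (2 - σ) * ((2 - σ) / 2) = 1 := by field_simp
    rw [← ENNReal.rpow_mul, e, ENNReal.rpow_one, mul_left_comm, hN', ENNReal.div_mul_cancel h0 h1]
  rw [lintegral_congr_ae hgN, lintegral_const_mul' _ _ hA']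
  refine mul_le_mul_right ?_ _
  refine (ENNReal.lintegral_mul_norm_pow_le (hN'm.pow_const _) hb (by positivity) hσ2
    (by ring)).trans ?_
  refine mul_le_mul_left (ENNReal.rpow_le_rpow (lintegral_mono_ae ?_) (by positivity)) _
  filter_upwards [hN'le] with t ht
  exact ENNReal.rpow_le_rpow ht (by positivity)

/-- Young: `Q√x ≤ Q²/2 + x/2`. Finiteness of `x` is essential, since half of it is subtracted from
both sides. -/
lemma le_of_le_add_mul_sqrt {x P Q : ℝ≥0∞} (hx : x ≠ ⊤)
    (h : x ≤ P + Q * x ^ (1 / 2 : ℝ)) : x ≤ 2 * P + Q ^ 2 := by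
  by_cases hP : P = ⊤
  · simp [hP]
  by_cases hQ : Q = ⊤
  · simp [hQ]
  lift x to ℝ≥0 using hx
  lift P to ℝ≥0 using hP
  lift Q to ℝ≥0 using hQ
  rw [← ENNReal.coe_rpow_of_nonneg _ (by norm_num), ← NNReal.sqrt_eq_rpow] at h
  norm_cast at h ⊢
  have h1 : (x : ℝ) ≤ P + Q * √(x : ℝ) := by
    have := NNReal.coe_le_coe.2 h
    simpa only [NNReal.coe_add, NNReal.coe_mul, Real.coe_sqrt] using this
  have h2 : √(x : ℝ) ^ 2 = x := Real.sq_sqrt x.2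
  have h3 : (x : ℝ) ≤ 2 * P + Q ^ 2 := by nlinarith [sq_nonneg ((Q : ℝ) - √(x : ℝ))]
  exact_mod_cast h3

/-! ### The terms of the local energy inequality for a suitable weak solution -/

section Solution

variable {x₀ : R3} {t₀ r : ℝ} {u : R3 × ℝ → R3} {Du : R3 × ℝ → Matrix (Fin 3) (Fin 3) ℝ}
  {p : R3 × ℝ → ℝ}

lemma sqNorm_nonneg (M : Matrix (Fin 3) (Fin 3) ℝ) : 0 ≤ sqNorm M :=
  Finset.sum_nonneg fun _ _ => Finset.sum_nonneg fun _ _ => sq_nonneg _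

lemma IsSuitableWeakSolution.integrable_sqNorm_mul {Ω : Set R3} {a b : ℝ}
    (h : IsSuitableWeakSolution Ω a b u Du p) {φ : R3 × ℝ → ℝ} (hφ : Continuous φ)
    (hφ0 : ∀ z, 0 ≤ φ z) (hφ1 : ∀ z, φ z ≤ 1) :
    Integrable (fun z => sqNorm (Du z) * φ z) (volume.restrict (Ω ×ˢ Ioo a b)) := by
  have h1 : Integrable (fun z => sqNorm (Du z)) (volume.restrict (Ω ×ˢ Ioo a b)) := by
    refine integrable_finsetSum _ fun i _ => integrable_finsetSum _ fun j _ => ?_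
    exact (h.gradient_memLp i j).integrable_sq
  refine h1.mul_bdd (c := 1) hφ.aestronglyMeasurable (Filter.Eventually.of_forall fun z => ?_)
  rw [Real.norm_eq_abs, abs_of_nonneg (hφ0 z)]
  exact hφ1 z

/-- The local energy inequality in terms of iterated lower integrals. -/
lemma IsSuitableWeakSolution.energy_lintegral {Ω : Set R3} {a b : ℝ}
    (h : IsSuitableWeakSolution Ω a b u Du p) {φ : R3 × ℝ → ℝ} (hφ : ContDiff ℝ ∞ φ)
    (hc : HasCompactSupport φ) (hφ0 : ∀ z, 0 ≤ φ z) (hφ1 : ∀ z, φ z ≤ 1)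
    (hU : ∃ U, IsOpen U ∧ parabolicBoundary Ω a b ⊆ U ∧ ∀ z ∈ U, φ z = 0) :
    ∀ᵐ t ∂volume.restrict (Ioo a b),
      (∫⁻ x in Ω, ENNReal.ofReal (φ (x, t) * ‖u (x, t)‖ ^ 2)) +
        ∫⁻ s in Ioo a t, ∫⁻ x in Ω, ENNReal.ofReal (φ (x, s) * sqNorm (Du (x, s))) ≤
      (∫⁻ s in Ioo a b, ‖∫ x in Ω, ‖u (x, s)‖ ^ 2 *
        (dt φ (x, s) + ∑ j, dx j (dx j φ) (x, s))‖ₑ) +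
      ∫⁻ s in Ioo a b, ‖∫ x in Ω, (‖u (x, s)‖ ^ 2 + 2 * p (x, s)) *
        ∑ j, u (x, s) j * pd j (fun y => φ (y, s)) x‖ₑ := by
  have h1 := (ae_restrict_iff' measurableSet_Ioo).2 (h.energy φ hφ hc hφ0 hU)
  have h2 := ae_memLp_slice (by norm_num) (by norm_num) h.u_memLp
  filter_upwards [h1, h2, ae_restrict_mem measurableSet_Ioo] with t ht hut htI
  have hsub : Ioo a t ⊆ Ioo a b := Ioo_subset_Ioo_right htI.2.le
  have i1 : Integrable (fun x => ‖u (x, t)‖ ^ 2 * φ (x, t)) (volume.restrict Ω) := by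
    refine Integrable.mul_bdd (c := 1) ?_ ?_ (Filter.Eventually.of_forall fun x => ?_)
    · simpa using hut.integrable_norm_pow (by norm_num)
    · exact (hφ.continuous.comp (by fun_prop)).aestronglyMeasurable
    · rw [Real.norm_eq_abs, abs_of_nonneg (hφ0 _)]
      exact hφ1 _
  have i2 := (h.integrable_sqNorm_mul hφ.continuous hφ0 hφ1).mono_measure
    (Measure.restrict_mono (prod_mono_right hsub) le_rfl)
  have e1 : ∫⁻ x in Ω, ENNReal.ofReal (φ (x, t) * ‖u (x, t)‖ ^ 2) =
      ENNReal.ofReal (∫ x in Ω, ‖u (x, t)‖ ^ 2 * φ (x, t)) := by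
    rw [ofReal_integral_eq_lintegral_ofReal i1
      (Filter.Eventually.of_forall fun x => mul_nonneg (by positivity) (hφ0 _))]
    simp only [mul_comm]
  have e2 : ∫⁻ s in Ioo a t, ∫⁻ x in Ω, ENNReal.ofReal (φ (x, s) * sqNorm (Du (x, s))) =
      ENNReal.ofReal (∫ z in Ω ×ˢ Ioo a t, sqNorm (Du z) * φ z) := by
    rw [ofReal_integral_eq_lintegral_ofReal i2
      (Filter.Eventually.of_forall fun x => mul_nonneg (sqNorm_nonneg _) (hφ0 _))]
    have hm := i2.1.aemeasurable.ennreal_ofReal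
    rw [Measure.volume_eq_prod, ← Measure.prod_restrict] at hm ⊢
    rw [lintegral_prod_symm _ hm]
    simp only [mul_comm]
  have n1 : 0 ≤ ∫ x in Ω, ‖u (x, t)‖ ^ 2 * φ (x, t) :=
    integral_nonneg fun x => mul_nonneg (by positivity) (hφ0 _)
  have n2 : 0 ≤ ∫ z in Ω ×ˢ Ioo a t, sqNorm (Du z) * φ z :=
    integral_nonneg fun x => mul_nonneg (sqNorm_nonneg _) (hφ0 _)
  rw [e1, e2, ← ENNReal.ofReal_add n1 n2]
  have q1 := (enorm_setIntegral_prod_le (fun z => ‖u z‖ ^ 2 * (dt φ z + ∑ j, dx j (dx j φ) z))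
    Ω (Ioo a t)).trans (lintegral_mono_set hsub)
  have q2 := (enorm_setIntegral_prod_le (fun z => (‖u z‖ ^ 2 + 2 * p z) * ∑ j, u z j * dx j φ z)
    Ω (Ioo a t)).trans (lintegral_mono_set hsub)
  simp only [dx_eq_pd hφ] at q2 ht
  refine le_trans ?_ (add_le_add q1 q2)
  have hofReal : ∀ y : ℝ, ENNReal.ofReal y ≤ ‖y‖ₑ := fun y => by
    rw [← ofReal_norm]
    exact ENNReal.ofReal_le_ofReal (le_abs_self y)
  refine le_trans (ENNReal.ofReal_le_ofReal ?_)
    (ENNReal.ofReal_add_le.trans (add_le_add (hofReal _) (hofReal _)))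
  -- Of the factor 2 on the gradient integral only one copy is kept.
  linarith

end Solution

lemma aemeasurable_enorm_slice_integral {F : R3 × ℝ → ℝ} {S : Set R3} {J : Set ℝ}
    (hF : AEStronglyMeasurable F (volume.restrict (S ×ˢ J))) :
    AEMeasurable (fun t => ‖∫ x in S, F (x, t)‖ₑ) (volume.restrict J) := by
  rw [Measure.volume_eq_prod, ← Measure.prod_restrict] at hF
  exact hF.prod_swap.integral_prod_right'.enorm

lemma aemeasurable_slice_lintegral {F : R3 × ℝ → ℝ≥0∞} {S : Set R3} {J : Set ℝ}
    (hF : AEMeasurable F (volume.restrict (S ×ˢ J))) :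
    AEMeasurable (fun t => ∫⁻ x in S, F (x, t)) (volume.restrict J) := by
  rw [Measure.volume_eq_prod, ← Measure.prod_restrict] at hF
  exact hF.prod_swap.lintegral_prod_right'

section Solution

variable {x₀ : R3} {t₀ r : ℝ} {u : R3 × ℝ → R3} {Du : R3 × ℝ → Matrix (Fin 3) (Fin 3) ℝ}
  {p : R3 × ℝ → ℝ}

/-- The gradient bound `K/r³`, integrated over a time interval of length `r²`, becomes `K/r`, the
same as the `L²` bound. Hence the powers `(1-σ)/2` and `σ/2` merge into `1/2` for every `σ`. -/
lemma linear_term_le {σ : ℝ} (hσ : σ ∈ Icc (0 : ℝ) 1) (hr : 0 < r) {K : ℝ} (hK : 0 < K)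
    (hu : AEStronglyMeasurable u (volume.restrict (Metric.ball x₀ r ×ˢ Ioo (t₀ - r ^ 2) t₀)))
    {ψ : R3 × ℝ → ℝ} (hψ : ContDiff ℝ ∞ ψ)
    (hs : ∀ t, tsupport (fun x => ψ (x, t)) ⊆ Metric.ball x₀ r)
    (hψ1 : ∀ t, ∫⁻ x, ‖ψ (x, t)‖ₑ ^ 2 ≤ ENNReal.ofReal (K / r))
    (hψ2 : ∀ t, gradEnergy (fun x => ψ (x, t)) ≤ ENNReal.ofReal (K / r ^ 3)) :
    ∫⁻ s in Ioo (t₀ - r ^ 2) t₀, ‖∫ x in Metric.ball x₀ r, ‖u (x, s)‖ ^ 2 * ψ (x, s)‖ₑ ≤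
      ENNReal.ofReal (K / r) ^ (1 / 2 : ℝ) *
        (∫⁻ t in Ioo (t₀ - r ^ 2) t₀, dualNorm σ x₀ r (fun x => ‖u (x, t)‖ ^ 2) ^ (2 / (2 - σ))) ^
          ((2 - σ) / 2) := by
  have ha : ENNReal.ofReal (K / r) ≠ 0 := by
    rw [Ne, ENNReal.ofReal_eq_zero, not_le]; positivity
  have hb : ENNReal.ofReal (K / r ^ 3) ≠ 0 := by
    rw [Ne, ENNReal.ofReal_eq_zero, not_le]; positivity
  have h1 : 0 ≤ (1 - σ) / 2 := by linarith [hσ.2]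
  have h2 : 0 ≤ σ / 2 := by linarith [hσ.1]
  have hF : AEStronglyMeasurable (fun z => ‖u z‖ ^ 2 * ψ z)
      (volume.restrict (Metric.ball x₀ r ×ˢ Ioo (t₀ - r ^ 2) t₀)) :=
    (hu.norm.pow 2).mul hψ.continuous.aestronglyMeasurable
  have key := lintegral_le_mul_of_le_mul_rpow hσ (ν := volume.restrict (Ioo (t₀ - r ^ 2) t₀))
    (N := fun t => dualNorm σ x₀ r (fun x => ‖u (x, t)‖ ^ 2))
    (A := ENNReal.ofReal (K / r) ^ ((1 - σ) / 2)) (b := fun _ => ENNReal.ofReal (K / r ^ 3))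
    (ENNReal.rpow_pos (pos_iff_ne_zero.2 ha) ENNReal.ofReal_ne_top).ne'
    (ENNReal.rpow_ne_top_of_nonneg h1 ENNReal.ofReal_ne_top)
    (aemeasurable_enorm_slice_integral hF) aemeasurable_const (fun _ => hb)
    (Filter.Eventually.of_forall fun _ => ENNReal.ofReal_ne_top)
    (Filter.Eventually.of_forall fun t => enorm_integral_test_le hσ
      (hψ.comp (contDiff_id.prodMk contDiff_const)) (hs t) ha ENNReal.ofReal_ne_top hb
      ENNReal.ofReal_ne_top (hψ1 t) (hψ2 t))
  refine key.trans (le_of_eq ?_)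
  have e1 : ∫⁻ _ in Ioo (t₀ - r ^ 2) t₀, ENNReal.ofReal (K / r ^ 3) = ENNReal.ofReal (K / r) := by
    rw [setLIntegral_const, Real.volume_Ioo, ← ENNReal.ofReal_mul (by positivity)]
    congr 1
    field_simp
    ring
  rw [e1, mul_left_comm, ← ENNReal.rpow_add_of_nonneg _ _ h1 h2, mul_comm]
  congr 2
  ring

lemma flux_term_le {σ : ℝ} (hσ : σ ∈ Icc (0 : ℝ) 1) (hr : 0 < r) {K : ℝ} (hK : 0 < K)
    (h : IsSuitableWeakSolution (Metric.ball x₀ r) (t₀ - r ^ 2) t₀ u Du p)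
    {φ : R3 × ℝ → ℝ} (hφ : ContDiff ℝ ∞ φ) (hφ0 : ∀ z, 0 ≤ φ z) (hφ1 : ∀ z, φ z ≤ 1)
    (hs : ∀ t, tsupport (fun x => φ (x, t)) ⊆ Metric.closedBall x₀ (3 / 4 * r))
    (h₁ : ∀ t j x, pd j (fun y => φ (y, t)) x ^ 2 ≤ K / r ^ 2 * φ (x, t))
    (h₂ : ∀ t j k x, pd k (pd j (fun y => φ (y, t))) x ^ 2 ≤ K / r ^ 4 * φ (x, t))
    {E : ℝ≥0∞} (hE : E ≠ 0) (hE' : E ≠ ⊤)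
    (he : ∀ᵐ t ∂volume.restrict (Ioo (t₀ - r ^ 2) t₀),
      ∫⁻ x in Metric.ball x₀ r, ENNReal.ofReal (φ (x, t) * ‖u (x, t)‖ ^ 2) ≤ E)
    (hd : ∫⁻ t in Ioo (t₀ - r ^ 2) t₀,
      ∫⁻ x in Metric.ball x₀ r, ENNReal.ofReal (φ (x, t) * sqNorm (Du (x, t))) ≤ E) :
    ∫⁻ s in Ioo (t₀ - r ^ 2) t₀, ‖∫ x in Metric.ball x₀ r, (‖u (x, s)‖ ^ 2 + 2 * p (x, s)) *
        ∑ j, u (x, s) j * pd j (fun y => φ (y, s)) x‖ₑ ≤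
      (ENNReal.ofReal (24 * K / r ^ 2) * E) ^ (1 / 2 : ℝ) *
        (∫⁻ t in Ioo (t₀ - r ^ 2) t₀,
          dualNorm σ x₀ r (fun x => ‖u (x, t)‖ ^ 2 + 2 * p (x, t)) ^ (2 / (2 - σ))) ^
          ((2 - σ) / 2) := by
  set d : ℝ → ℝ≥0∞ := fun t =>
    ∫⁻ x in Metric.ball x₀ r, ENNReal.ofReal (φ (x, t) * sqNorm (Du (x, t))) with hd_def
  have h1 : 0 ≤ (1 - σ) / 2 := by linarith [hσ.2]
  have h2 : 0 ≤ σ / 2 := by linarith [hσ.1]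
  have ha : ENNReal.ofReal (24 * K / r ^ 2) * E ≠ 0 := by
    refine mul_ne_zero ?_ hE
    rw [Ne, ENNReal.ofReal_eq_zero, not_le]; positivity
  have ha' : ENNReal.ofReal (24 * K / r ^ 2) * E ≠ ⊤ := ENNReal.mul_ne_top ENNReal.ofReal_ne_top hE'
  have hc : ENNReal.ofReal (18 * (K / r ^ 4)) * E ≠ 0 := by
    refine mul_ne_zero ?_ hE
    rw [Ne, ENNReal.ofReal_eq_zero, not_le]; positivity
  have hdm : AEMeasurable d (volume.restrict (Ioo (t₀ - r ^ 2) t₀)) := by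
    refine aemeasurable_slice_lintegral
      (F := fun z => ENNReal.ofReal (φ z * sqNorm (Du z))) ?_
    have := (h.integrable_sqNorm_mul hφ.continuous hφ0 hφ1).1.aemeasurable.ennreal_ofReal
    simpa only [mul_comm] using this
  have hdtop : ∀ᵐ t ∂volume.restrict (Ioo (t₀ - r ^ 2) t₀), d t < ⊤ :=
    ae_lt_top' hdm (hd.trans_lt hE'.lt_top).ne
  have hF : AEStronglyMeasurable
      (fun z : R3 × ℝ => (‖u z‖ ^ 2 + 2 * p z) * ∑ j, u z j * dx j φ z)
      (volume.restrict (Metric.ball x₀ r ×ˢ Ioo (t₀ - r ^ 2) t₀)) := by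
    refine ((h.u_memLp.1.norm.pow 2).add (h.p_memLp.1.const_mul 2)).mul ?_
    refine Finset.aestronglyMeasurable_fun_sum _ fun j _ => ?_
    exact ((EuclideanSpace.proj (𝕜 := ℝ) j).continuous.comp_aestronglyMeasurable h.u_memLp.1).mul
      (contDiff_dx hφ j).continuous.aestronglyMeasurable
  have hFm := aemeasurable_enorm_slice_integral hF
  simp only [dx_eq_pd hφ] at hFm
  have hb := hdm.const_mul (ENNReal.ofReal (6 * (K / r ^ 2)))
  -- The constant `24 = 6 + 18` makes the time integral of `b` at most `24K/r² · E`, the quantity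
  -- inside `A`, so the exponents again add to `1/2`. The summand with `E` keeps `b` nonzero even
  -- where `d` vanishes.
  have key := lintegral_le_mul_of_le_mul_rpow hσ (ν := volume.restrict (Ioo (t₀ - r ^ 2) t₀))
    (N := fun t => dualNorm σ x₀ r (fun x => ‖u (x, t)‖ ^ 2 + 2 * p (x, t)))
    (A := (ENNReal.ofReal (24 * K / r ^ 2) * E) ^ ((1 - σ) / 2))
    (b := fun t => ENNReal.ofReal (6 * (K / r ^ 2)) * d t + ENNReal.ofReal (18 * (K / r ^ 4)) * E)
    (ENNReal.rpow_pos (pos_iff_ne_zero.2 ha) ha').ne'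
    (ENNReal.rpow_ne_top_of_nonneg h1 ha') hFm (hb.add_const _)
    (fun t => by simp only [ne_eq, add_eq_zero, not_and]; exact fun _ => hc)
    (by
      filter_upwards [hdtop] with t ht
      exact ENNReal.add_ne_top.2 ⟨ENNReal.mul_ne_top ENNReal.ofReal_ne_top ht.ne,
        ENNReal.mul_ne_top ENNReal.ofReal_ne_top hE'⟩) ?_
  · refine key.trans ?_
    have e1 : ∫⁻ t in Ioo (t₀ - r ^ 2) t₀, (ENNReal.ofReal (6 * (K / r ^ 2)) * d t +
        ENNReal.ofReal (18 * (K / r ^ 4)) * E) ≤ ENNReal.ofReal (24 * K / r ^ 2) * E := by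
      rw [lintegral_add_left' hb, lintegral_const_mul'' _ hdm, setLIntegral_const, Real.volume_Ioo]
      have e2 : ENNReal.ofReal (18 * (K / r ^ 4)) * E * ENNReal.ofReal (t₀ - (t₀ - r ^ 2)) =
          ENNReal.ofReal (18 * (K / r ^ 2)) * E := by
        rw [mul_right_comm, ← ENNReal.ofReal_mul (by positivity)]
        congr 2
        field_simp
        ring
      rw [e2]
      calc _ ≤ ENNReal.ofReal (6 * (K / r ^ 2)) * E + ENNReal.ofReal (18 * (K / r ^ 2)) * E := by
            gcongr
        _ = _ := by
          rw [← add_mul, ← ENNReal.ofReal_add (by positivity) (by positivity)]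
          congr 2
          ring
    refine (mul_le_mul_right (mul_le_mul_right (ENNReal.rpow_le_rpow e1 h2) _) _).trans
      (le_of_eq ?_)
    rw [mul_left_comm, ← ENNReal.rpow_add_of_nonneg _ _ h1 h2, mul_comm]
    congr 2
    ring
  · have g1 := ae_memLp_slice (by norm_num) (by norm_num) h.u_memLp
    have g2 := ae_memLp_slice (by norm_num) (ENNReal.div_ne_top (by simp) (by simp)) h.p_memLp
    have g3 : ∀ᵐ t ∂volume.restrict (Ioo (t₀ - r ^ 2) t₀), ∀ i j, MemLp (fun x => Du (x, t) i j) 2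
        (volume.restrict (Metric.ball x₀ r)) :=
      ae_all_iff.2 fun i => ae_all_iff.2 fun j =>
        ae_memLp_slice (by norm_num) (by norm_num) (h.gradient_memLp i j)
    have g4 := (ae_restrict_iff' measurableSet_Ioo).2 h.gradient
    filter_upwards [g1, g2, g3, g4, he, hdtop] with t q1 q2 q3 q4 q5 q6
    refine enorm_flux_le hσ (ρ := 3 / 4 * r) (by linarith) (by linarith) q1 q3 q4 q2
      (φ := fun x => φ (x, t)) (hφ.comp (contDiff_id.prodMk contDiff_const)) (hs t)
      (fun x => hφ0 _) (c₁ := K / r ^ 2) (c₂ := K / r ^ 4) (by positivity) (by positivity)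
      (h₁ t) (h₂ t) ha ha' ?_ ?_ ?_ ?_
    · simp only [ne_eq, add_eq_zero, not_and]; exact fun _ => hc
    · exact ENNReal.add_ne_top.2 ⟨ENNReal.mul_ne_top ENNReal.ofReal_ne_top q6.ne,
        ENNReal.mul_ne_top ENNReal.ofReal_ne_top hE'⟩
    · refine mul_le_mul' (ENNReal.ofReal_le_ofReal ?_) q5
      rw [mul_div_assoc]
      have : 0 ≤ K / r ^ 2 := by positivity
      linarith
    · exact add_le_add le_rfl (mul_le_mul_right q5 _)

end Solution

/-! ### Assembling the energy bound and the theorem -/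

/-- The energy inequality holds only at almost every time before the final one. Good times exist
arbitrarily close to `b`, and monotone convergence reaches the whole interval. -/
lemma setLIntegral_Ioo_le_of_ae {a b : ℝ} (hab : a < b) {d : ℝ → ℝ≥0∞} {R : ℝ≥0∞}
    (h : ∀ᵐ t ∂volume.restrict (Ioo a b), ∫⁻ s in Ioo a t, d s ≤ R) :
    ∫⁻ s in Ioo a b, d s ≤ R := by
  have hU : Ioo a b = ⋃ n : ℕ, Ioo a (b - 1 / ((n : ℝ) + 1)) := by
    ext t
    simp only [mem_Ioo, mem_iUnion]
    constructor
    · rintro ⟨h1, h2⟩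
      obtain ⟨n, hn⟩ := exists_nat_one_div_lt (sub_pos.2 h2)
      exact ⟨n, h1, by linarith⟩
    · rintro ⟨n, h1, h2⟩
      have : 0 < 1 / ((n : ℝ) + 1) := by positivity
      exact ⟨h1, by linarith⟩
  have hmono : Monotone fun n : ℕ => Ioo a (b - 1 / ((n : ℝ) + 1)) := by
    intro m n hmn
    refine Ioo_subset_Ioo_right (sub_le_sub_left ?_ _)
    exact one_div_le_one_div_of_le (by positivity) (by exact_mod_cast Nat.succ_le_succ hmn)
  rw [hU, setLIntegral_iUnion_of_directed _ hmono.directed_le]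
  refine iSup_le fun n => ?_
  have hpos : 0 < 1 / ((n : ℝ) + 1) := by positivity
  set c := max a (b - 1 / ((n : ℝ) + 1)) with hc
  have hcb : c < b := max_lt hab (by linarith)
  have hne : (ae (volume.restrict (Ioo c b))).NeBot := by
    rw [ae_neBot, Ne, Measure.restrict_eq_zero, Real.volume_Ioo, ENNReal.ofReal_eq_zero, not_le]
    linarith
  have hsub : Ioo c b ⊆ Ioo a b := Ioo_subset_Ioo_left (le_max_left a _)
  have h' : ∀ᵐ t ∂volume.restrict (Ioo c b), ∫⁻ s in Ioo a t, d s ≤ R :=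
    ae_mono (Measure.restrict_mono hsub le_rfl) h
  obtain ⟨t, ht, htm⟩ := (h'.and (ae_restrict_mem measurableSet_Ioo)).exists
  exact (lintegral_mono_set (Ioo_subset_Ioo_right ((le_max_right _ _).trans htm.1.le))).trans ht

/-- The localized energy is controlled by the dual norms. -/
lemma exists_energy_bound {σ : ℝ} (hσ : σ ∈ Icc (0 : ℝ) 1) : ∃ K : ℝ, 0 < K ∧
    ∀ (x₀ : R3) (t₀ r : ℝ), 0 < r → ∀ (u : R3 × ℝ → R3)
      (Du : R3 × ℝ → Matrix (Fin 3) (Fin 3) ℝ) (p : R3 × ℝ → ℝ),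
      IsSuitableWeakSolution (Metric.ball x₀ r) (t₀ - r ^ 2) t₀ u Du p →
      ∃ E : ℝ≥0∞, scaledA u x₀ t₀ (r / 2) ≤ (ENNReal.ofReal (r / 2))⁻¹ * E ∧
        scaledB Du x₀ t₀ (r / 2) ≤ (ENNReal.ofReal (r / 2))⁻¹ * E ∧
        E ≤ 2 * (ENNReal.ofReal (K / r) ^ (1 / 2 : ℝ) *
            (∫⁻ t in Ioo (t₀ - r ^ 2) t₀,
              dualNorm σ x₀ r (fun x => ‖u (x, t)‖ ^ 2) ^ (2 / (2 - σ))) ^ ((2 - σ) / 2)) +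
          ENNReal.ofReal (24 * K / r ^ 2) *
            (∫⁻ t in Ioo (t₀ - r ^ 2) t₀,
              dualNorm σ x₀ r (fun x => ‖u (x, t)‖ ^ 2 + 2 * p (x, t)) ^ (2 / (2 - σ))) ^
              (2 - σ) := by
  obtain ⟨K, hK, hcut⟩ := exists_cutoff
  refine ⟨K, hK, fun x₀ t₀ r hr u Du p h => ?_⟩
  obtain ⟨φ, hφ, hφc, hφ0, hφ1, hout, hone, hφs, h₁, h₂, hψs, hψ1, hψ2⟩ := hcut x₀ t₀ r hr
  have hr2 : 0 < r ^ 2 := by positivity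
  have hab : t₀ - r ^ 2 < t₀ := by linarith
  set ν := (volume : Measure ℝ).restrict (Ioo (t₀ - r ^ 2) t₀) with hν
  set e : ℝ → ℝ≥0∞ := fun t =>
    ∫⁻ x in Metric.ball x₀ r, ENNReal.ofReal (φ (x, t) * ‖u (x, t)‖ ^ 2) with he
  set d : ℝ → ℝ≥0∞ := fun t =>
    ∫⁻ x in Metric.ball x₀ r, ENNReal.ofReal (φ (x, t) * sqNorm (Du (x, t))) with hd
  set E : ℝ≥0∞ := max (essSup e ν) (∫⁻ t, d t ∂ν) with hE
  have heE : ∀ᵐ t ∂ν, e t ≤ E := by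
    filter_upwards [ae_le_essSup (f := e) (μ := ν)] with t ht
    exact ht.trans (le_max_left _ _)
  have hsqm : AEMeasurable (fun z => ENNReal.ofReal (φ z * sqNorm (Du z)))
      (volume.restrict (Metric.ball x₀ r ×ˢ Ioo (t₀ - r ^ 2) t₀)) := by
    have := (h.integrable_sqNorm_mul hφ.continuous hφ0 hφ1).1.aemeasurable.ennreal_ofReal
    simpa only [mul_comm] using this
  have hdprod : ∫⁻ t, d t ∂ν = ∫⁻ z in Metric.ball x₀ r ×ˢ Ioo (t₀ - r ^ 2) t₀,
      ENNReal.ofReal (φ z * sqNorm (Du z)) := by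
    rw [Measure.volume_eq_prod, ← Measure.prod_restrict] at hsqm ⊢
    rw [lintegral_prod_symm _ hsqm]
  refine ⟨E, ?_, ?_, ?_⟩
  · refine essSup_le_of_ae_le _ ?_
    have q1 : ∀ᵐ t ∂(volume : Measure ℝ), t ∈ Ioo (t₀ - r ^ 2) t₀ → e t ≤ E :=
      (ae_restrict_iff' measurableSet_Ioo).1 heE
    have q2 : ∀ᵐ t ∂(volume : Measure ℝ), t ≠ t₀ := Measure.ae_ne volume t₀
    filter_upwards [ae_restrict_of_ae q1, ae_restrict_of_ae q2,
      ae_restrict_mem measurableSet_Icc] with t ht1 ht2 ht3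
    have ht4 : t ∈ Ioo (t₀ - r ^ 2) t₀ :=
      ⟨by nlinarith [ht3.1], lt_of_le_of_ne ht3.2 ht2⟩
    refine mul_le_mul_right (le_trans ?_ (ht1 ht4)) _
    refine le_trans ?_ (lintegral_mono_set (Metric.ball_subset_ball (by linarith : r / 2 ≤ r)))
    refine setLIntegral_mono' measurableSet_ball fun x hx => le_of_eq ?_
    rw [hone (x, t) ⟨Metric.ball_subset_closedBall hx, by nlinarith [ht3.1], ht3.2⟩, one_mul,
      ENNReal.ofReal_pow (norm_nonneg _), ofReal_norm]
  · refine mul_le_mul_right (le_trans ?_ (le_max_right _ _)) _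
    rw [hdprod]
    refine le_trans ?_ (lintegral_mono_set (prod_mono
      (Metric.ball_subset_ball (by linarith : r / 2 ≤ r))
      (Ioo_subset_Ioo_left (by nlinarith : t₀ - r ^ 2 ≤ t₀ - (r / 2) ^ 2))))
    refine setLIntegral_mono' (measurableSet_ball.prod measurableSet_Ioo) fun z hz => le_of_eq ?_
    rw [hone z ⟨Metric.ball_subset_closedBall hz.1, by nlinarith [hz.2.1], hz.2.2.le⟩, one_mul]
  -- `flux_term_le` requires `E` nonzero; when it vanishes the bound is trivial.
  · by_cases hE0 : E = 0
    · rw [hE0]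
      exact zero_le
    -- Finiteness, needed for absorption, comes from `u ∈ L^∞L²` and `∇u ∈ L²` on the full cylinder.
    have hEtop : E ≠ ⊤ := by
      refine (max_lt ?_ ?_).ne
      · obtain ⟨M, hM⟩ := h.u_bounded
        refine (essSup_le_of_ae_le (M : ℝ≥0∞) ?_).trans_lt ENNReal.coe_lt_top
        filter_upwards [(ae_restrict_iff' measurableSet_Ioo).2 hM] with t ht
        refine le_trans (lintegral_mono fun x => ?_) ht
        rw [← ofReal_norm, ← ENNReal.ofReal_pow (norm_nonneg _)]
        exact ENNReal.ofReal_le_ofReal (mul_le_of_le_one_left (by positivity) (hφ1 _))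
      · rw [hdprod]
        have := (h.integrable_sqNorm_mul hφ.continuous hφ0 hφ1).lintegral_lt_top
        simpa only [mul_comm] using this
    have hU : ∃ U, IsOpen U ∧ parabolicBoundary (Metric.ball x₀ r) (t₀ - r ^ 2) t₀ ⊆ U ∧
        ∀ z ∈ U, φ z = 0 := by
      refine ⟨_, (Metric.isClosed_closedBall.prod isClosed_Icc).isOpen_compl, ?_, hout⟩
      rintro ⟨x, t⟩ (⟨-, ht⟩ | ⟨hx, -⟩) ⟨hx', ht'⟩
      · have h1 : t = t₀ - r ^ 2 := ht
        have h2 : t₀ - r ^ 2 / 2 ≤ t := ht'.1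
        linarith
      · rw [frontier_ball x₀ hr.ne'] at hx
        have h1 : dist x x₀ = r := hx
        have h2 : dist x x₀ ≤ 3 / 4 * r := hx'
        linarith
    have hen := h.energy_lintegral hφ hφc hφ0 hφ1 hU
    have hψd : ContDiff ℝ ∞ fun z => dt φ z + ∑ j, dx j (dx j φ) z :=
      (contDiff_dt hφ).add (ContDiff.sum fun j _ => contDiff_dx (contDiff_dx hφ j) j)
    have l1 := linear_term_le hσ hr hK h.u_memLp.1 hψd
      (fun t => (hψs t).trans (Metric.closedBall_subset_ball (by linarith))) hψ1 hψ2
    have l2 := flux_term_le hσ hr hK h hφ hφ0 hφ1 hφs h₁ h₂ hE0 hEtop heE (le_max_right _ _)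
    have hEle := max_le
      (essSup_le_of_ae_le _ (hen.mono fun t ht => (le_self_add.trans ht).trans (add_le_add l1 l2)))
      (setLIntegral_Ioo_le_of_ae hab
        (hen.mono fun t ht => (le_add_self.trans ht).trans (add_le_add l1 l2)))
    rw [ENNReal.mul_rpow_of_nonneg _ _ (by norm_num), mul_right_comm] at hEle
    refine (le_of_le_add_mul_sqrt hEtop hEle).trans (le_of_eq ?_)
    congr 1
    rw [mul_pow, ← ENNReal.rpow_natCast, ← ENNReal.rpow_mul, ← ENNReal.rpow_natCast,
      ← ENNReal.rpow_mul]
    norm_num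
    rfl

end NavierStokes

theorem theorem1p8 (σ : ℝ) (hσ : σ ∈ Set.Icc (0 : ℝ) 1) :
    ∃ C : ℝ≥0, 0 < C ∧
      ∀ (x₀ : NavierStokes.R3) (t₀ r : ℝ), 0 < r →
      ∀ (u : NavierStokes.R3 × ℝ → NavierStokes.R3)
        (Du : NavierStokes.R3 × ℝ → Matrix (Fin 3) (Fin 3) ℝ) (p : NavierStokes.R3 × ℝ → ℝ),
        NavierStokes.IsSuitableWeakSolution (Metric.ball x₀ r) (t₀ - r ^ 2) t₀ u Du p →
        NavierStokes.scaledA u x₀ t₀ (r / 2) + NavierStokes.scaledB Du x₀ t₀ (r / 2) ≤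
          (C : ℝ≥0∞) * NavierStokes.scaledC σ u x₀ t₀ r ^ ((2 - σ) / 2) +
          (C : ℝ≥0∞) *
            NavierStokes.scaledDual σ (fun z => ‖u z‖ ^ 2 + 2 * p z) x₀ t₀ r ^ (2 - σ) := by
  obtain ⟨K, hK, hbound⟩ := NavierStokes.exists_energy_bound hσ
  -- Two copies of `(r/2)⁻¹ E` give `4E/r`; multiplying `2(K/r)^{1/2}` and `24K/r²` by `4/r`
  -- produces `8K^{1/2} r^{-3/2}` and `96K r^{-3}`, exactly the powers of `r` in the scaled
  -- quantities.
  refine ⟨(8 * K ^ (1 / 2 : ℝ) + 96 * K).toNNReal, Real.toNNReal_pos.2 (by positivity),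
    fun x₀ t₀ r hr u Du p h => ?_⟩
  obtain ⟨E, hA, hB, hE⟩ := hbound x₀ t₀ r hr u Du p h
  have h2σ : 0 < 2 - σ := by linarith [hσ.2]
  rw [NavierStokes.scaledC, NavierStokes.scaledDual, NavierStokes.scaledDual,
    ENNReal.mul_rpow_of_nonneg _ _ (by positivity), ENNReal.mul_rpow_of_nonneg _ _ h2σ.le,
    ← ENNReal.rpow_mul, ← ENNReal.rpow_mul]
  set Y := (∫⁻ t in Ioo (t₀ - r ^ 2) t₀,
    NavierStokes.dualNorm σ x₀ r (fun x => ‖u (x, t)‖ ^ 2) ^ (2 / (2 - σ))) ^ ((2 - σ) / 2)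
  set X := (∫⁻ t in Ioo (t₀ - r ^ 2) t₀, NavierStokes.dualNorm σ x₀ r
    (fun x => ‖u (x, t)‖ ^ 2 + 2 * p (x, t)) ^ (2 / (2 - σ))) ^ (2 - σ)
  have e1 : -(3 / (2 - σ)) * ((2 - σ) / 2) = -(3 / 2) := by field_simp
  have e2 : -(3 / (2 - σ)) * (2 - σ) = -3 := by field_simp
  rw [e1, e2, ENNReal.ofReal_rpow_of_pos hr, ENNReal.ofReal_rpow_of_pos hr, ← mul_assoc,
    ← mul_assoc]
  change _ ≤ ENNReal.ofReal _ * _ * _ + ENNReal.ofReal _ * _ * _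
  rw [← ENNReal.ofReal_mul (by positivity), ← ENNReal.ofReal_mul (by positivity)]
  rw [← ENNReal.ofReal_inv_of_pos (by positivity)] at hA hB
  have hr32 : r⁻¹ * r⁻¹ ^ (1 / 2 : ℝ) = r ^ (-(3 / 2) : ℝ) := by
    rw [Real.inv_rpow hr.le, ← Real.rpow_neg hr.le, ← Real.rpow_neg_one, ← Real.rpow_add hr]
    norm_num
  have hr3 : r ^ (-3 : ℝ) = r⁻¹ ^ 3 := by
    rw [Real.rpow_neg hr.le, inv_pow]
    norm_cast
  calc _ ≤ ENNReal.ofReal (r / 2)⁻¹ * E + ENNReal.ofReal (r / 2)⁻¹ * E := add_le_add hA hB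
    _ = ENNReal.ofReal (4 * r⁻¹) * E := by
      rw [← add_mul, ← ENNReal.ofReal_add (by positivity) (by positivity)]
      congr 2
      field_simp
      norm_num
    _ ≤ ENNReal.ofReal (4 * r⁻¹) *
        (2 * (ENNReal.ofReal (K / r) ^ (1 / 2 : ℝ) * Y) + ENNReal.ofReal (24 * K / r ^ 2) * X) :=
      mul_le_mul_right hE _
    _ = ENNReal.ofReal (8 * K ^ (1 / 2 : ℝ) * r ^ (-(3 / 2) : ℝ)) * Y +
        ENNReal.ofReal (96 * K * r ^ (-3 : ℝ)) * X := by
      rw [mul_add, ENNReal.ofReal_rpow_of_pos (by positivity), ← ENNReal.ofReal_ofNat 2,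
        ← mul_assoc, ← mul_assoc, ← mul_assoc, ← ENNReal.ofReal_mul (by positivity),
        ← ENNReal.ofReal_mul (by positivity), ← ENNReal.ofReal_mul (by positivity), div_eq_mul_inv K,
        Real.mul_rpow hK.le (by positivity), ← hr32, hr3]
      congr 3
      · ring
      · field_simp
        norm_num
    _ ≤ _ := by
      gcongr
      · have : 0 < K ^ (1 / 2 : ℝ) := by positivity
        linarith
      · have : 0 < K ^ (1 / 2 : ℝ) := by positivity
        linarith
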